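/- Let $m\le d$, let $A\in\mathbb R^{d\times d}$ be Hurwitz (all complex eigenvalues of $A$ have negative real part), and let $B\in\mathbb R^{d\times m}$ be such that $(A,B)$ is controllable, i.e. the matrix $(B,AB,\ldots,A^{d-1}B)$ has rank $d$. For $x\in\mathbb R^d$ let $(X^x_t)_{t\ge 0}$ be the solution of the stochastic differential equation $$dX_t=AX_t\,dt+B\,dW_t,\qquad X_0=x,$$ where $W$ is an $m$-dimensional Brownian motion. Let $$d\mu(x)=(2\pi)^{-d/2}(\det\Sigma)^{-1/2}\exp\bigl(-\tfrac12x^\top\Sigma^{-1}x\bigr)\,dx,\qquad \Sigma=\int_0^\infty e^{As}BB^\top e^{A^\top s}\,ds,$$ be its stationary distribution, and let $K^t$, $t\ge0$, be the Koopman operator, acting on $f\in L^2(\mu)$ by $(K^tf)(x)=\mathbb E[f(X_t)\mid X_0=x]=\mathbb E[f(X^x_t)]$. For $\sigma>0$ let $\mathbb H_\sigma$, with norm $\|\cdot\|_\sigma$, be the reproducing kernel Hilbert space of functions on $\mathbb R^d$ generated by the RBF kernel $k^\sigma(x,y)=\exp(-\|x-y\|^2/\sigma^2)$. Let $\sigma>0$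 and assume that $$\tfrac12(A+A^\top)\le\tfrac1{\sigma^2}BB^\top$$ in the Loewner order; this holds, for example, if $A$ is dissipative, i.e. $A+A^\top\le0$. Then $\mathbb H_\sigma$ is invariant under every $K^t$, $t\ge0$: for each $f\in\mathbb H_\sigma$ one has $f\in L^2(\mu)$, the expectation $\mathbb E[f(X^x_t)]$ exists for every $x$, and the function $x\mapsto\mathbb E[f(X_t^x)]$ belongs to $\mathbb H_\sigma$; moreover this function does not change, up to a $\mu$-null set, when $f$ is replaced by a function that equals $f$ $\mu$-almost everywhere, so that it represents $K^tf\in L^2(\mu)$. Moreover, $$\|K^tf\|_\sigma\le e^{t\operatorname{Tr}(-A)/2}\,\|f\|_\sigma,\qquad f\in\mathbb H_\sigma .$$ -/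

import Mathlib

open MeasureTheory ProbabilityTheory
open scoped NNReal Matrix

/-! ### Matrices -/

/-- `(A, B)` is controllable: the `d × (d * m)` matrix `(B, A B, …, A ^ (d - 1) B)` has rank `d`. -/
def IsControllable {d m : ℕ} (A : Matrix (Fin d) (Fin d) ℝ) (B : Matrix (Fin d) (Fin m) ℝ) : Prop :=
  (Matrix.of fun (i : Fin d) (kj : Fin d × Fin m) => (A ^ (kj.1 : ℕ) * B) i kj.2).rank = d

/-- `A` is Hurwitz: all its complex eigenvalues have negative real part. -/
def IsHurwitz {d : ℕ} (A : Matrix (Fin d) (Fin d) ℝ) : Prop :=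
  ∀ z : ℂ, Module.End.HasEigenvalue (Matrix.toLin' (A.map Complex.ofReal)) z → z.re < 0

/-- `A` is dissipative: `A + Aᵀ ≤ 0` in the Loewner order. -/
def IsDissipative {d : ℕ} (A : Matrix (Fin d) (Fin d) ℝ) : Prop :=
  (-(A + Aᵀ)).PosSemidef

/-- `½ (A + Aᵀ) ≤ σ⁻² B Bᵀ` in the Loewner order. -/
def LyapunovCondition {d m : ℕ} (A : Matrix (Fin d) (Fin d) ℝ) (B : Matrix (Fin d) (Fin m) ℝ)
    (σ : ℝ) : Prop :=
  ((1 / σ ^ 2) • (B * Bᵀ) - (1 / 2 : ℝ) • (A + Aᵀ)).PosSemidef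

/-! ### The stationary distribution -/

section Gramian

open scoped Matrix.Norms.L2Operator

/-- The controllability Gramian `Σ = ∫_0^∞ e^{As} B Bᵀ e^{Aᵀs} ds` (the integral converges when `A`
is Hurwitz; it does not depend on the choice of the norm on matrices). -/
noncomputable def gramian {d m : ℕ} (A : Matrix (Fin d) (Fin d) ℝ) (B : Matrix (Fin d) (Fin m) ℝ) :
    Matrix (Fin d) (Fin d) ℝ :=
  ∫ s in Set.Ioi (0 : ℝ), NormedSpace.exp (s • A) * (B * Bᵀ) * NormedSpace.exp (s • Aᵀ)

end Gramian

/-- The stationary distribution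
`dμ(x) = (2π)^{-d/2} (det Σ)^{-1/2} exp (-½ xᵀ Σ⁻¹ x) dx`. -/
noncomputable def stationaryMeasure {d m : ℕ} (A : Matrix (Fin d) (Fin d) ℝ)
    (B : Matrix (Fin d) (Fin m) ℝ) : Measure (EuclideanSpace ℝ (Fin d)) :=
  volume.withDensity fun x => ENNReal.ofReal
    ((2 * Real.pi) ^ (-(d : ℝ) / 2) * (gramian A B).det ^ (-(1 / 2) : ℝ) *
      Real.exp (-(1 / 2) * (x.ofLp ⬝ᵥ ((gramian A B)⁻¹ *ᵥ x.ofLp))))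

/-! ### The stochastic differential equation and its Koopman operators -/

/-- `m`-dimensional Brownian motion: the coordinates are independent real Brownian motions. -/
structure IsBrownianVector {Ω : Type*} [MeasurableSpace Ω] {m : ℕ}
    (W : ℝ≥0 → Ω → EuclideanSpace ℝ (Fin m)) (P : Measure Ω) : Prop where
  isBrownianReal : ∀ i, IsBrownianReal (fun t ω => W t ω i) P
  iIndepFun : iIndepFun (fun (i : Fin m) (ω : Ω) (t : ℝ≥0) => W t ω i) P

/-- `X` solves `dX_t = A X_t dt + B dW_t`, `X_0 = x`, for the `m`-dimensional Brownian motion `W`: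
it has almost surely continuous paths and
`X_t = x + ∫_0^t A X_s ds + B W_t` for all `t ≥ 0`, almost surely. Since the diffusion coefficient
is constant, the Itô integral `∫_0^t B dW_s` is `B W_t`. -/
structure IsSolutionSDE {Ω : Type*} [MeasurableSpace Ω] {d m : ℕ}
    (A : Matrix (Fin d) (Fin d) ℝ) (B : Matrix (Fin d) (Fin m) ℝ) (x : EuclideanSpace ℝ (Fin d))
    (W : ℝ≥0 → Ω → EuclideanSpace ℝ (Fin m)) (X : ℝ≥0 → Ω → EuclideanSpace ℝ (Fin d))
    (P : Measure Ω) : Prop where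
  brownian : IsBrownianVector W P
  continuous_paths : ∀ᵐ ω ∂P, Continuous fun t => X t ω
  equation : ∀ᵐ ω ∂P, ∀ t : ℝ≥0,
    X t ω = x + (∫ s in (0 : ℝ)..t, A.toEuclideanLin (X s.toNNReal ω)) + B.toEuclideanLin (W t ω)

/-- The Koopman operator `(K^t f)(x) = 𝔼[f(X_t) | X_0 = x]`, where under `P x` the process `X x`
starts at `x`. -/
noncomputable def koopman {Ω : Type*} [MeasurableSpace Ω] {d : ℕ}
    (P : EuclideanSpace ℝ (Fin d) → Measure Ω)
    (X : EuclideanSpace ℝ (Fin d) → ℝ≥0 → Ω → EuclideanSpace ℝ (Fin d))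
    (t : ℝ≥0) (f : EuclideanSpace ℝ (Fin d) → ℝ) : EuclideanSpace ℝ (Fin d) → ℝ :=
  fun x => ∫ ω, f (X x t ω) ∂(P x)

/-! ### The Gaussian RKHS -/

/-- The RBF kernel `k^σ(x, y) = exp (-‖x - y‖² / σ²)`, as an operator-valued kernel on `ℝ`
(the real number acts by multiplication). -/
noncomputable def rbfKernel (d : ℕ) (σ : ℝ) :
    Matrix (EuclideanSpace ℝ (Fin d)) (EuclideanSpace ℝ (Fin d)) (ℝ →L[ℝ] ℝ) :=
  Matrix.of fun x y => Real.exp (-‖x - y‖ ^ 2 / σ ^ 2) • ContinuousLinearMap.id ℝ ℝ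

theorem rbfKernel_eq_integral_cos {d : ℕ} (σ : ℝ) (u : EuclideanSpace ℝ (Fin d)) :
    Real.exp (-‖u‖ ^ 2 / σ ^ 2) =
      ∫ z, Real.cos (inner ℝ z ((√2 / σ) • u)) ∂(stdGaussian (EuclideanSpace ℝ (Fin d))) := by
  have h := charFun_stdGaussian ((√2 / σ) • u)
  rw [charFun_apply] at h
  have h2 := congrArg Complex.re h
  have hint : Integrable (fun z : EuclideanSpace ℝ (Fin d) =>
      Complex.exp ((inner ℝ z ((√2 / σ) • u) : ℝ) * Complex.I))
      (stdGaussian (EuclideanSpace ℝ (Fin d))) := by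
    refine Integrable.of_bound (C := 1) (by fun_prop) (Filter.Eventually.of_forall fun z => ?_)
    rw [Complex.norm_exp_ofReal_mul_I]
  have h3 := integral_re hint
  simp only [RCLike.re_eq_complex_re] at h3
  rw [← h3] at h2
  simp only [Complex.exp_ofReal_mul_I_re] at h2
  rw [h2, ← Complex.ofReal_pow, ← Complex.ofReal_neg]
  have : (((-‖(√2 / σ) • u‖ ^ 2 : ℝ) : ℂ) / 2) = ((-‖(√2 / σ) • u‖ ^ 2 / 2 : ℝ) : ℂ) := by
    push_cast; ring
  rw [this, Complex.exp_ofReal_re, norm_smul, mul_pow, Real.norm_eq_abs, sq_abs, div_pow,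
    Real.sq_sqrt (by norm_num)]
  congr 1
  ring

theorem rbfKernel_posSemidef (d : ℕ) (σ : ℝ) : (rbfKernel d σ).PosSemidef := by
  have tfae : (rbfKernel d σ).PosSemidef ↔ (rbfKernel d σ).IsHermitian ∧
      ∀ v : EuclideanSpace ℝ (Fin d) →₀ ℝ,
        0 ≤ RCLike.re (v.sum fun x w => v.sum fun x' w' => inner ℝ (rbfKernel d σ x' x w) w') :=
    RKHS.posSemidef_tfae.out 0 2
  refine tfae.mpr ⟨?_, fun v => ?_⟩
  · ext x y
    simp [rbfKernel, Matrix.conjTranspose_apply, norm_sub_rev x y, star_smul,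
      ContinuousLinearMap.star_eq_adjoint, ContinuousLinearMap.adjoint_id]
  · have key : (v.sum fun x w => v.sum fun x' w' => inner ℝ (rbfKernel d σ x' x w) w') =
        ∫ z, ((∑ x ∈ v.support, v x * Real.cos (inner ℝ z ((√2 / σ) • x))) ^ 2 +
          (∑ x ∈ v.support, v x * Real.sin (inner ℝ z ((√2 / σ) • x))) ^ 2)
          ∂(stdGaussian (EuclideanSpace ℝ (Fin d))) := by
      have e : ∀ z : EuclideanSpace ℝ (Fin d),
          (∑ x ∈ v.support, v x * Real.cos (inner ℝ z ((√2 / σ) • x))) ^ 2 +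
          (∑ x ∈ v.support, v x * Real.sin (inner ℝ z ((√2 / σ) • x))) ^ 2 =
          ∑ x ∈ v.support, ∑ y ∈ v.support,
            v x * v y * Real.cos (inner ℝ z ((√2 / σ) • (y - x))) := by
        intro z
        rw [sq, sq, Finset.sum_mul_sum, Finset.sum_mul_sum, ← Finset.sum_add_distrib]
        refine Finset.sum_congr rfl fun x _ => ?_
        rw [← Finset.sum_add_distrib]
        refine Finset.sum_congr rfl fun y _ => ?_
        rw [smul_sub, inner_sub_right, Real.cos_sub]
        ring
      have hint : ∀ u : EuclideanSpace ℝ (Fin d),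
          Integrable (fun z => Real.cos (inner ℝ z u))
            (stdGaussian (EuclideanSpace ℝ (Fin d))) := fun u =>
        Integrable.of_bound (C := 1) (by fun_prop)
          (Filter.Eventually.of_forall fun z => by
            rw [Real.norm_eq_abs]; exact Real.abs_cos_le_one _)
      simp_rw [e]
      rw [integral_finsetSum _ fun x _ => integrable_finsetSum _ fun y _ =>
        (hint _).const_mul _]
      refine Finset.sum_congr rfl fun x _ => ?_
      rw [integral_finsetSum _ fun y _ => (hint _).const_mul _]
      refine Finset.sum_congr rfl fun y _ => ?_
      rw [integral_const_mul, ← rbfKernel_eq_integral_cos]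
      simp [rbfKernel]
      ring
    rw [key]
    exact integral_nonneg fun z => by positivity

instance rbfKernel_fact (d : ℕ) (σ : ℝ) : Fact (rbfKernel d σ).PosSemidef :=
  ⟨rbfKernel_posSemidef d σ⟩

/-- The Gaussian RKHS `ℍ_σ`: the Hilbert space of functions on `ℝ^d` with reproducing
kernel `k^σ`. -/
noncomputable abbrev GaussianRKHS (d : ℕ) (σ : ℝ) : Type :=
  RKHS.OfKernel (rbfKernel d σ)

/-! ### The matrix exponential -/

section MatrixExponential

open scoped Matrix.Norms.L2Operator

variable {n : Type*} [Fintype n] [DecidableEq n]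

/-! Since point evaluations are inner products with kernel functions, `K^t f` at `x` is `⟨m_x, f⟩`,
where `m_x` is the kernel mean embedding of the law of `X_t^x`. By duality, `x ↦ ⟨m_x, f⟩` is an
element of `ℍ_σ` of norm at most `C ‖f‖` as soon as `‖∑ c_x m_x‖ ≤ C ‖∑ c_x k(·, x)‖` for all finite
combinations (`RKHS.exists_of_forall_abs_sum_le`).

Both norms are computed on the Fourier side: up to one common constant, `‖∑ c_x m_x‖²` is the
integral of `|∑ c_x χ_x(w)|² exp(-σ²|w|²/4)`, with `χ_x` the characteristic function of the law
(`norm_sum_meanEmbedding_sq`). The law of `X_t^x` is Gaussian with mean `e^{tA} x` and covariance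
`Σ_t`, so `χ_x(w)` is the character of the point mass at `x` evaluated at `Lw`, `L = e^{tAᵀ}`, times
`exp(-wᵀ Σ_t w / 2)`. The Lyapunov condition integrates to `σ²/4 |Lw|² ≤ σ²/4 |w|² + wᵀ Σ_t w`
(`LyapunovCondition.norm_exp_sq_le`). Hence the integrand for the `m_x` is at most the integrand for
the kernel functions at `Lw`, and substituting `Lw` costs `(det L)⁻¹ = e^{-t Tr A}`, whose square
root is `C` (`norm_sum_meanEmbedding_le`).

The law is found without stochastic integration (`IsSolutionSDE.charFun_map`): variation of
constants holds path by path, summation by parts turns it into a limit of sums over Brownian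
increments, and independence gives their characteristic functions.

Independence of the representative uses nondegeneracy: controllability makes `Σ_t` positive definite
for `t > 0`, so the law of `X_t^x` is absolutely continuous with respect to Lebesgue measure, hence
to `μ`. The Hurwitz property makes `Σ` converge. -/

theorem Matrix.hasDerivAt_exp_smul (M : Matrix n n ℝ) (s : ℝ) :
    HasDerivAt (fun u : ℝ => NormedSpace.exp (u • M)) (M * NormedSpace.exp (s • M)) s :=
  hasDerivAt_exp_smul_const' M s

theorem Matrix.continuous_exp_smul (M : Matrix n n ℝ) :
    Continuous fun u : ℝ => NormedSpace.exp (u • M) :=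
  continuous_iff_continuousAt.2 fun s => (M.hasDerivAt_exp_smul s).continuousAt

theorem Matrix.exp_smul_mul_self (M : Matrix n n ℝ) (s : ℝ) :
    NormedSpace.exp (s • M) * M = M * NormedSpace.exp (s • M) :=
  (((Commute.refl M).smul_left s).exp_left).eq

theorem Matrix.exp_add_smul (M : Matrix n n ℝ) (s t : ℝ) :
    NormedSpace.exp ((s + t) • M) = NormedSpace.exp (s • M) * NormedSpace.exp (t • M) := by
  rw [add_smul, Matrix.exp_add_of_commute]
  exact ((Commute.refl M).smul_left s).smul_right t

theorem Matrix.hasDerivAt_mulVec {p q : Type*} [Fintype p] [Fintype q] {F : ℝ → Matrix p q ℝ}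
    {F' : Matrix p q ℝ} {s : ℝ} (h : ∀ i j, HasDerivAt (fun u => F u i j) (F' i j) s) (y : q → ℝ) :
    HasDerivAt (fun u => F u *ᵥ y) (F' *ᵥ y) s := by
  rw [hasDerivAt_pi]
  intro i
  simp only [Matrix.mulVec, dotProduct]
  exact HasDerivAt.fun_sum fun j _ => (h i j).mul_const _

theorem HasDerivAt.matrix_apply {F : ℝ → Matrix n n ℝ} {F' : Matrix n n ℝ} {s : ℝ}
    (h : HasDerivAt F F' s) (i j : n) : HasDerivAt (fun u => F u i j) (F' i j) s :=
  (LinearMap.toContinuousLinearMap (Matrix.entryLinearMap ℝ ℝ i j)).hasFDerivAt.comp_hasDerivAt s h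

theorem Matrix.hasDerivAt_exp_smul_mulVec (M : Matrix n n ℝ) (y : n → ℝ) (s : ℝ) :
    HasDerivAt (fun u : ℝ => NormedSpace.exp (u • M) *ᵥ y)
      (M *ᵥ (NormedSpace.exp (s • M) *ᵥ y)) s := by
  rw [Matrix.mulVec_mulVec]
  exact Matrix.hasDerivAt_mulVec (fun i j => (M.hasDerivAt_exp_smul s).matrix_apply i j) y

theorem Matrix.hasDerivAt_mulVec_exp_smul_mulVec {p : Type*} [Fintype p] (N : Matrix p n ℝ)
    (M : Matrix n n ℝ) (y : n → ℝ) (s : ℝ) :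
    HasDerivAt (fun u : ℝ => N *ᵥ (NormedSpace.exp (u • M) *ᵥ y))
      (N *ᵥ (M *ᵥ (NormedSpace.exp (s • M) *ᵥ y))) s :=
  (LinearMap.toContinuousLinearMap (Matrix.mulVecLin N)).hasFDerivAt.comp_hasDerivAt s
    (M.hasDerivAt_exp_smul_mulVec y s)

theorem Matrix.hasDerivAt_det_exp_smul_zero (M : Matrix n n ℝ) :
    HasDerivAt (fun u : ℝ => (NormedSpace.exp (u • M)).det) M.trace 0 := by
  have h : ∀ i j, HasDerivAt (fun u : ℝ => NormedSpace.exp (u • M) i j) (M i j) 0 := fun i j => by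
    simpa using (M.hasDerivAt_exp_smul 0).matrix_apply i j
  have h2 : HasDerivAt (fun u : ℝ => (NormedSpace.exp (u • M)).det)
      (∑ τ : Equiv.Perm n, (Equiv.Perm.sign τ : ℤ) • ∑ i, (∏ j ∈ Finset.univ.erase i,
        NormedSpace.exp ((0 : ℝ) • M) (τ j) j) • M (τ i) i) 0 := by
    simp only [Matrix.det_apply]
    refine HasDerivAt.fun_sum fun τ _ => ?_
    exact (HasDerivAt.fun_finsetProd fun i _ => h (τ i) i).const_smul _
  convert h2 using 1
  rw [Finset.sum_eq_single 1]
  · simp [Matrix.trace]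
  · intro τ _ hτ
    rw [Finset.sum_eq_zero, smul_zero]
    intro i _
    -- A permutation other than the identity moves at least two points, so after removing the factor
    -- `i` the product still contains an off-diagonal entry of `exp 0 = 1`.
    obtain ⟨j, hj, hji⟩ : ∃ j, τ j ≠ j ∧ j ≠ i := by
      by_contra! hcon
      apply hτ
      ext j
      by_cases hji : j = i
      · subst hji
        by_contra hne
        have := hcon (τ j) (fun e => hne (τ.injective e))
        exact hne this
      · by_contra hne
        exact hji (hcon j hne)
    rw [Finset.prod_eq_zero (i := j), zero_smul]
    · simp [hji]
    · simp [hj]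
  · simp

/-- The group law carries the derivative at `0` to every point, so `det (e^{uM}) e^{-u Tr M}` has
zero derivative. -/
theorem Matrix.det_exp_smul (M : Matrix n n ℝ) (t : ℝ) :
    (NormedSpace.exp (t • M)).det = Real.exp (t * M.trace) := by
  have h1 : ∀ s : ℝ, HasDerivAt (fun u : ℝ => (NormedSpace.exp (u • M)).det)
      ((NormedSpace.exp (s • M)).det * M.trace) s := by
    intro s
    have h0 : HasDerivAt (fun u : ℝ => (NormedSpace.exp (u • M)).det) M.trace (s + -s) := by
      rw [add_neg_cancel]
      exact M.hasDerivAt_det_exp_smul_zero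
    have h2 := (h0.comp_add_const s (-s)).const_mul (NormedSpace.exp (s • M)).det
    refine h2.congr_of_eventuallyEq (.of_forall fun u => ?_)
    dsimp only
    rw [← Matrix.det_mul, ← Matrix.exp_add_smul, add_neg_cancel_comm_assoc]
  have h3 : ∀ s : ℝ, HasDerivAt
      (fun u : ℝ => (NormedSpace.exp (u • M)).det * Real.exp (-(u * M.trace))) 0 s := by
    intro s
    have h4 : HasDerivAt (fun u : ℝ => Real.exp (-(u * M.trace)))
        (Real.exp (-(s * M.trace)) * (-(1 * M.trace))) s :=
      (((hasDerivAt_id s).mul_const _).neg).exp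
    exact ((h1 s).mul h4).congr_deriv (by ring)
  have h5 := is_const_of_deriv_eq_zero (fun s => (h3 s).differentiableAt) (fun s => (h3 s).deriv) t 0
  simp only [zero_smul, NormedSpace.exp_zero, Matrix.det_one, zero_mul, neg_zero, Real.exp_zero,
    mul_one] at h5
  rw [Real.exp_neg] at h5
  field_simp at h5
  exact h5

end MatrixExponential

/-! ### The Gramian -/

section Gramian

open scoped Matrix.Norms.L2Operator
open Filter Topology

variable {d m : ℕ}

/-- The output `Bᵀ e^{sAᵀ} x` of the dual system. -/
noncomputable def dualOutput (A : Matrix (Fin d) (Fin d) ℝ) (B : Matrix (Fin d) (Fin m) ℝ)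
    (x : Fin d → ℝ) (s : ℝ) : Fin m → ℝ :=
  Bᵀ *ᵥ (NormedSpace.exp (s • Aᵀ) *ᵥ x)

/-- Differentiation only replaces `x` by `Aᵀ x`, so repeated derivatives of the output produce the
vectors `Bᵀ (Aᵀ)^k x` of the rank condition. -/
theorem hasDerivAt_dualOutput (A : Matrix (Fin d) (Fin d) ℝ) (B : Matrix (Fin d) (Fin m) ℝ)
    (x : Fin d → ℝ) (s : ℝ) : HasDerivAt (dualOutput A B x) (dualOutput A B (Aᵀ *ᵥ x) s) s := by
  have h := Matrix.hasDerivAt_mulVec_exp_smul_mulVec Bᵀ Aᵀ x s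
  rwa [Matrix.mulVec_mulVec x Aᵀ, ← Matrix.exp_smul_mul_self, ← Matrix.mulVec_mulVec] at h

theorem continuous_dualOutput (A : Matrix (Fin d) (Fin d) ℝ) (B : Matrix (Fin d) (Fin m) ℝ)
    (x : Fin d → ℝ) : Continuous (dualOutput A B x) :=
  continuous_iff_continuousAt.2 fun s => (hasDerivAt_dualOutput A B x s).continuousAt

theorem continuous_gramian_integrand (A : Matrix (Fin d) (Fin d) ℝ) (B : Matrix (Fin d) (Fin m) ℝ) :
    Continuous fun s : ℝ =>
      NormedSpace.exp (s • A) * (B * Bᵀ) * NormedSpace.exp (s • Aᵀ) :=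
  (A.continuous_exp_smul.mul continuous_const).mul Aᵀ.continuous_exp_smul

theorem dotProduct_gramian_integrand (A : Matrix (Fin d) (Fin d) ℝ) (B : Matrix (Fin d) (Fin m) ℝ)
    (x : Fin d → ℝ) (s : ℝ) :
    x ⬝ᵥ ((NormedSpace.exp (s • A) * (B * Bᵀ) * NormedSpace.exp (s • Aᵀ)) *ᵥ x) =
      dualOutput A B x s ⬝ᵥ dualOutput A B x s := by
  have h : NormedSpace.exp (s • A) = (NormedSpace.exp (s • Aᵀ))ᵀ := by
    rw [← Matrix.exp_transpose, Matrix.transpose_smul, Matrix.transpose_transpose]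
  rw [h, dualOutput, ← Matrix.mulVec_mulVec, ← Matrix.mulVec_mulVec, ← Matrix.mulVec_mulVec,
    Matrix.dotProduct_mulVec, Matrix.vecMul_transpose, Matrix.dotProduct_mulVec,
    ← Matrix.mulVec_transpose]

/-- `M ↦ xᵀ M x` as a continuous linear functional. -/
noncomputable def Matrix.quadraticFormCLM (x : Fin d → ℝ) : Matrix (Fin d) (Fin d) ℝ →L[ℝ] ℝ :=
  LinearMap.toContinuousLinearMap
    { toFun := fun M => x ⬝ᵥ (M *ᵥ x)
      map_add' := fun M N => by rw [Matrix.add_mulVec, dotProduct_add]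
      map_smul' := fun c M => by rw [Matrix.smul_mulVec, dotProduct_smul]; rfl }

theorem dotProduct_integral_mulVec {F : ℝ → Matrix (Fin d) (Fin d) ℝ} {μ : Measure ℝ}
    (hF : Integrable F μ) (x : Fin d → ℝ) :
    x ⬝ᵥ ((∫ s, F s ∂μ) *ᵥ x) = ∫ s, x ⬝ᵥ (F s *ᵥ x) ∂μ := 
  ((Matrix.quadraticFormCLM x).integral_comp_comm hF).symm

theorem transpose_integral {F : ℝ → Matrix (Fin d) (Fin d) ℝ} {μ : Measure ℝ}
    (hF : Integrable F μ) : (∫ s, F s ∂μ)ᵀ = ∫ s, (F s)ᵀ ∂μ :=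
  ((LinearMap.toContinuousLinearMap
    (Matrix.transposeLinearEquiv (Fin d) (Fin d) ℝ ℝ).toLinearMap).integral_comp_comm hF).symm

/-- Full rank makes the rows of the controllability matrix independent, so a vector annihilating all
its columns vanishes. Only `k < d` enters. -/
theorem IsControllable.eq_zero {A : Matrix (Fin d) (Fin d) ℝ} {B : Matrix (Fin d) (Fin m) ℝ}
    (hAB : IsControllable A B) {x : Fin d → ℝ}
    (hx : ∀ k : ℕ, Bᵀ *ᵥ ((Aᵀ) ^ k *ᵥ x) = 0) : x = 0 := by
  set C : Matrix (Fin d) (Fin d × Fin m) ℝ :=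
    Matrix.of fun (i : Fin d) (kj : Fin d × Fin m) => (A ^ (kj.1 : ℕ) * B) i kj.2 with hC
  have hrank : C.rank = d := hAB
  have hli : LinearIndependent ℝ C.row := by
    rw [linearIndependent_iff_card_eq_finrank_span, Fintype.card_fin]
    exact hrank.symm.trans C.rank_eq_finrank_span_row
  have hinj := Matrix.vecMul_injective_iff.2 hli
  apply hinj
  simp only [Matrix.zero_vecMul]
  ext ⟨k, j⟩
  have h := congrFun (hx k) j
  rw [Matrix.mulVec_mulVec, ← Matrix.transpose_pow, ← Matrix.transpose_mul,
    Matrix.mulVec_transpose] at h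
  exact h

theorem IsControllable.eq_zero_of_dualOutput_eq_zero {A : Matrix (Fin d) (Fin d) ℝ}
    {B : Matrix (Fin d) (Fin m) ℝ} (hAB : IsControllable A B) {x : Fin d → ℝ} {t : ℝ} (ht : 0 < t)
    (hx : ∀ s ∈ Set.Ioo 0 t, dualOutput A B x s = 0) : x = 0 := by
  have h : ∀ k : ℕ, ∀ s ∈ Set.Ioo 0 t, dualOutput A B ((Aᵀ) ^ k *ᵥ x) s = 0 := by
    intro k
    induction k with
    | zero => simpa using hx
    | succ k ih =>
      intro s hs
      have h1 := hasDerivAt_dualOutput A B ((Aᵀ) ^ k *ᵥ x) s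
      have h2 : HasDerivAt (dualOutput A B ((Aᵀ) ^ k *ᵥ x)) 0 s := by
        refine (hasDerivAt_const s (0 : Fin m → ℝ)).congr_of_eventuallyEq ?_
        filter_upwards [Ioo_mem_nhds hs.1 hs.2] with u hu using ih u hu
      rw [Matrix.mulVec_mulVec, ← pow_succ'] at h1
      exact h1.unique h2
  -- Any interior time would do. Commuting the exponential past `(Aᵀ)^k` puts `e^{(t/2)Aᵀ} x` in the
  -- kernel of every `Bᵀ (Aᵀ)^k`, and the exponential is invertible.
  have h0 : NormedSpace.exp ((t / 2) • Aᵀ) *ᵥ x = 0 := by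
    refine hAB.eq_zero fun k => ?_
    have h1 := h k (t / 2) ⟨by linarith, by linarith⟩
    have hcomm : NormedSpace.exp ((t / 2) • Aᵀ) * (Aᵀ) ^ k =
        (Aᵀ) ^ k * NormedSpace.exp ((t / 2) • Aᵀ) :=
      ((((Commute.refl Aᵀ).smul_left (t / 2)).exp_left).pow_right k).eq
    rw [dualOutput, Matrix.mulVec_mulVec x, hcomm, ← Matrix.mulVec_mulVec x] at h1
    exact h1
  have hu := Matrix.isUnit_exp ((t / 2) • Aᵀ)
  exact Matrix.mulVec_injective_of_isUnit hu (by rw [h0, Matrix.mulVec_zero])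

/-- The quadratic form is the integral of `|Bᵀ e^{sAᵀ} x|²`; if it is zero, the continuous output
vanishes on `(0, t)`. A general `S` serves both `Σ` on `(0, ∞)` and `Σ_t` on `(0, t]`. -/
theorem IsControllable.posDef_integral {A : Matrix (Fin d) (Fin d) ℝ}
    {B : Matrix (Fin d) (Fin m) ℝ} (hAB : IsControllable A B) {S : Set ℝ} {t : ℝ} (ht : 0 < t)
    (hS : Set.Ioo 0 t ⊆ S)
    (hint : IntegrableOn (fun s : ℝ =>
      NormedSpace.exp (s • A) * (B * Bᵀ) * NormedSpace.exp (s • Aᵀ)) S) :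
    (∫ s in S, NormedSpace.exp (s • A) * (B * Bᵀ) * NormedSpace.exp (s • Aᵀ)).PosDef := by
  refine Matrix.PosDef.of_dotProduct_mulVec_pos ?_ fun x hx => ?_
  · rw [Matrix.IsHermitian, Matrix.conjTranspose_eq_transpose_of_trivial, transpose_integral hint]
    congr 1
    ext1 s
    simp only [Matrix.transpose_mul, ← Matrix.exp_transpose, Matrix.transpose_smul,
      Matrix.transpose_transpose, Matrix.mul_assoc]
  · rw [star_trivial, dotProduct_integral_mulVec hint]
    have hint' : IntegrableOn (fun s => dualOutput A B x s ⬝ᵥ dualOutput A B x s) S := by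
      refine ((Matrix.quadraticFormCLM x).integrable_comp hint).congr (.of_forall fun s => ?_)
      exact dotProduct_gramian_integrand A B x s
    simp only [dotProduct_gramian_integrand]
    have hnn : ∀ s, 0 ≤ dualOutput A B x s ⬝ᵥ dualOutput A B x s := fun s =>
      Finset.sum_nonneg fun i _ => mul_self_nonneg _
    refine (integral_nonneg hnn).lt_of_ne fun h0 => hx ?_
    have hae := (integral_eq_zero_iff_of_nonneg hnn hint').1 h0.symm
    have hcont := continuous_dualOutput A B x
    have heq : Set.EqOn (fun s => dualOutput A B x s ⬝ᵥ dualOutput A B x s) 0 (Set.Ioo 0 t) :=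
      Measure.eqOn_open_of_ae_eq (μ := volume) (ae_restrict_of_ae_restrict_of_subset hS hae)
        isOpen_Ioo (by
          simp only [dotProduct]
          fun_prop) continuousOn_const
    exact hAB.eq_zero_of_dualOutput_eq_zero ht fun s hs => dotProduct_self_eq_zero.1 (heq hs)

/-- The covariance `∫_0^t e^{As} B Bᵀ e^{Aᵀs} ds` of the Ornstein-Uhlenbeck transition kernel. -/
noncomputable def transitionCov (A : Matrix (Fin d) (Fin d) ℝ) (B : Matrix (Fin d) (Fin m) ℝ)
    (t : ℝ) : Matrix (Fin d) (Fin d) ℝ :=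
  ∫ s in Set.Ioc 0 t, NormedSpace.exp (s • A) * (B * Bᵀ) * NormedSpace.exp (s • Aᵀ)

theorem integrableOn_transitionCov (A : Matrix (Fin d) (Fin d) ℝ) (B : Matrix (Fin d) (Fin m) ℝ)
    (t : ℝ) : IntegrableOn (fun s : ℝ =>
      NormedSpace.exp (s • A) * (B * Bᵀ) * NormedSpace.exp (s • Aᵀ)) (Set.Ioc 0 t) :=
  ((continuous_gramian_integrand A B).integrableOn_Icc).mono_set Set.Ioc_subset_Icc_self

theorem IsControllable.transitionCov_posDef {A : Matrix (Fin d) (Fin d) ℝ}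
    {B : Matrix (Fin d) (Fin m) ℝ} (hAB : IsControllable A B) {t : ℝ} (ht : 0 < t) :
    (transitionCov A B t).PosDef :=
  hAB.posDef_integral ht Set.Ioo_subset_Ioc_self (integrableOn_transitionCov A B t)

theorem dotProduct_transitionCov {A : Matrix (Fin d) (Fin d) ℝ}
    {B : Matrix (Fin d) (Fin m) ℝ} {t : ℝ} (ht : 0 ≤ t) (x : Fin d → ℝ) :
    x ⬝ᵥ (transitionCov A B t *ᵥ x) =
      ∫ s in (0 : ℝ)..t, dualOutput A B x s ⬝ᵥ dualOutput A B x s := by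
  rw [transitionCov, dotProduct_integral_mulVec (integrableOn_transitionCov A B t),
    intervalIntegral.integral_of_le ht]
  simp only [dotProduct_gramian_integrand]

end Gramian

/-! ### Exponential stability -/

section Hurwitz

open scoped Matrix.Norms.L2Operator
open Filter Topology

variable {d m : ℕ}

theorem Matrix.exp_mulVec_of_mulVec_eq_smul {M : Matrix (Fin d) (Fin d) ℂ} {v : Fin d → ℂ} {z : ℂ}
    (h : M *ᵥ v = z • v) : NormedSpace.exp M *ᵥ v = Complex.exp z • v := by
  have hpow : ∀ k : ℕ, (M ^ k) *ᵥ v = z ^ k • v := by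
    intro k
    induction k with
    | zero => simp
    | succ k ih =>
      rw [pow_succ, ← Matrix.mulVec_mulVec, h, Matrix.mulVec_smul, ih, smul_smul, pow_succ']
  let T : Matrix (Fin d) (Fin d) ℂ →ₗ[ℂ] (Fin d → ℂ) :=
    { toFun := fun N => N *ᵥ v
      map_add' := fun N N' => Matrix.add_mulVec N N' v
      map_smul' := fun c N => Matrix.smul_mulVec c N v }
  have h1 := (NormedSpace.exp_series_hasSum_exp' (𝕂 := ℂ) M).mapL (LinearMap.toContinuousLinearMap T)
  have h2 := (NormedSpace.exp_series_hasSum_exp' (𝕂 := ℂ) z).smul_const v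
  rw [Complex.exp_eq_exp_ℂ]
  refine h1.unique (h2.congr_fun ?_)
  intro k
  simp [T, hpow, smul_smul]

/-- The eigenspace of `e^M` for `z` is invariant under `M`, so over `ℂ` it contains an eigenvector
of `M`, with eigenvalue `c` say. Then `z = e^c` and `|z| = e^{Re c} < 1`. -/
theorem IsHurwitz.norm_lt_one_of_mem_spectrum {A : Matrix (Fin d) (Fin d) ℝ} (hA : IsHurwitz A)
    {z : ℂ} (hz : z ∈ spectrum ℂ (NormedSpace.exp (A.map Complex.ofReal))) : ‖z‖ < 1 := by
  set M := A.map Complex.ofReal with hM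
  rw [← Matrix.spectrum_toLin', ← Module.End.hasEigenvalue_iff_mem_spectrum] at hz
  set V := Module.End.eigenspace (Matrix.toLin' (NormedSpace.exp M)) z with hV
  have hcomm : Commute (Matrix.toLin' (NormedSpace.exp M)) (Matrix.toLin' M) := by
    rw [Commute, SemiconjBy, Module.End.mul_eq_comp, Module.End.mul_eq_comp,
      ← Matrix.toLin'_mul, ← Matrix.toLin'_mul]
    congr 1
    exact ((Commute.refl M).exp_left).eq
  have hmaps : ∀ v ∈ V, Matrix.toLin' M v ∈ V :=
    Module.End.mapsTo_genEigenspace_of_comm hcomm z 1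
  have : Nontrivial V := Submodule.nontrivial_iff_ne_bot.2 hz
  obtain ⟨c, hc⟩ := Module.End.exists_eigenvalue ((Matrix.toLin' M).restrict hmaps)
  obtain ⟨v, hv⟩ := hc.exists_hasEigenvector
  have hv1 : Matrix.toLin' M (v : Fin d → ℂ) = c • (v : Fin d → ℂ) :=
    congrArg Subtype.val hv.apply_eq_smul
  have hv0 : (v : Fin d → ℂ) ≠ 0 := fun h => hv.2 (Subtype.ext h)
  have hre : c.re < 0 :=
    hA c (Module.End.hasEigenvalue_of_hasEigenvector ⟨Module.End.mem_eigenspace_iff.2 hv1, hv0⟩)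
  have h1 := Matrix.exp_mulVec_of_mulVec_eq_smul (M := M) (v := v) (z := c) hv1
  have h2 : NormedSpace.exp M *ᵥ (v : Fin d → ℂ) = z • (v : Fin d → ℂ) :=
    Module.End.mem_eigenspace_iff.1 v.2
  have h3 : Complex.exp c = z := smul_left_injective ℂ hv0 (h1.symm.trans h2)
  rw [← h3, Complex.norm_exp]
  exact Real.exp_lt_one_iff.2 hre

/-- Gelfand's formula gives `‖a^n‖ ≤ r^n` eventually, for some `r < 1`. -/
theorem tendsto_norm_pow_of_spectralRadius_lt_one {𝔸 : Type*} [NormedRing 𝔸] [NormedAlgebra ℂ 𝔸]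
    [CompleteSpace 𝔸] {a : 𝔸} (ha : spectralRadius ℂ a < 1) :
    Tendsto (fun n : ℕ => ‖a ^ n‖) atTop (𝓝 0) := by
  obtain ⟨r, hr, hr1⟩ := exists_between ha
  have hrtop : r ≠ ⊤ := (hr1.trans ENNReal.one_lt_top).ne
  lift r to ℝ≥0 using hrtop
  have hr1' : (r : ℝ) < 1 := by exact_mod_cast hr1
  have hev := (spectrum.pow_nnnorm_pow_one_div_tendsto_nhds_spectralRadius a).eventually_lt_const hr
  refine squeeze_zero' (.of_forall fun n => norm_nonneg _) ?_
    (tendsto_pow_atTop_nhds_zero_of_lt_one r.2 hr1')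
  filter_upwards [hev, eventually_gt_atTop 0] with n hn hn0
  have h := ENNReal.rpow_le_rpow hn.le (z := n) (by positivity)
  rw [← ENNReal.rpow_mul, one_div_mul_cancel (by positivity), ENNReal.rpow_one,
    ENNReal.rpow_natCast] at h
  exact_mod_cast h

theorem IsHurwitz.exists_norm_exp_lt_one {A : Matrix (Fin d) (Fin d) ℝ} (hA : IsHurwitz A) :
    ∃ n : ℕ, 0 < n ∧ ‖NormedSpace.exp ((n : ℝ) • A)‖ < 1 := by
  rcases isEmpty_or_nonempty (Fin d) with hd | hd
  · exact ⟨1, one_pos, by rw [Subsingleton.elim (NormedSpace.exp _) 0, norm_zero]; exact one_pos⟩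
  have hsr : spectralRadius ℂ (NormedSpace.exp (A.map Complex.ofReal)) < 1 := by
    have := spectrum.spectralRadius_lt_of_forall_lt (NormedSpace.exp (A.map Complex.ofReal))
      (r := 1) fun z hz => by
        have := hA.norm_lt_one_of_mem_spectrum hz
        exact_mod_cast this
    exact_mod_cast this
  have htend := tendsto_norm_pow_of_spectralRadius_lt_one hsr
  -- Spectral theory takes place over `ℂ`. The entrywise real part is continuous and sends
  -- `(e^{A_ℂ})^n` to `e^{nA}`, which brings the decay back to `ℝ`.
  let R : Matrix (Fin d) (Fin d) ℂ →ₗ[ℝ] Matrix (Fin d) (Fin d) ℝ :=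
    { toFun := fun N => N.map Complex.re
      map_add' := fun N N' => by ext; simp
      map_smul' := fun c N => by ext; simp }
  let R' := LinearMap.toContinuousLinearMap R
  have hR : ∀ n : ℕ, NormedSpace.exp ((n : ℝ) • A) =
      R' (NormedSpace.exp (A.map Complex.ofReal) ^ n) := by
    intro n
    have hexp : (NormedSpace.exp (n • A)).map Complex.ofReal =
        NormedSpace.exp ((n • A).map Complex.ofReal) :=
      NormedSpace.map_exp_of_mem_ball (𝕂 := ℝ) (Complex.ofRealHom.mapMatrix (m := Fin d))
        (continuous_id.matrix_map Complex.continuous_ofReal) (n • A)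
        ((NormedSpace.expSeries_radius_eq_top ℝ (Matrix (Fin d) (Fin d) ℝ)).symm ▸ edist_lt_top _ _)
    have hsm : (n • A).map Complex.ofReal = n • A.map Complex.ofReal :=
      map_nsmul (Complex.ofRealHom.mapMatrix (m := Fin d)) n A
    rw [Nat.cast_smul_eq_nsmul, ← Matrix.exp_nsmul, ← hsm, ← hexp]
    ext i j
    simp [R', R]
  have h0 : Tendsto (fun n : ℕ => ‖NormedSpace.exp ((n : ℝ) • A)‖) atTop (𝓝 0) := by
    simp only [hR]
    have := ((R'.continuous.tendsto 0).comp (tendsto_zero_iff_norm_tendsto_zero.2 htend)).norm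
    simpa using this
  obtain ⟨n, hn, hn0⟩ := ((h0.eventually_lt_const one_pos).and (eventually_gt_atTop 0)).exists
  exact ⟨n, hn0, hn⟩

theorem IsHurwitz.exists_norm_exp_le {A : Matrix (Fin d) (Fin d) ℝ} (hA : IsHurwitz A) :
    ∃ K c : ℝ, 0 < c ∧ ∀ s : ℝ, 0 ≤ s → ‖NormedSpace.exp (s • A)‖ ≤ K * Real.exp (-c * s) := by
  obtain ⟨n, hn, hlt⟩ := hA.exists_norm_exp_lt_one
  have hn' : (0 : ℝ) < n := by exact_mod_cast hn
  -- Choosing `q` strictly above the norm keeps it positive even if the norm is `0`, so `log q` can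
  -- serve as a rate.
  obtain ⟨q, hq1, hq2⟩ := exists_between hlt
  have hq0 : 0 < q := (norm_nonneg _).trans_lt hq1
  obtain ⟨C, hC⟩ := (isCompact_Icc (a := (0 : ℝ)) (b := n)).exists_bound_of_continuousOn
    A.continuous_exp_smul.continuousOn
  have hC0 : 0 ≤ C := (norm_nonneg _).trans (hC 0 ⟨le_rfl, hn'.le⟩)
  have hstep : ∀ k : ℕ, ∀ s ∈ Set.Icc (0 : ℝ) n,
      ‖NormedSpace.exp ((s + k * n) • A)‖ ≤ C * q ^ k := by
    intro k
    induction k with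
    | zero => simpa using hC
    | succ k ih =>
      intro s hs
      have e : s + ((k + 1 : ℕ) : ℝ) * n = (s + k * n) + n := by push_cast; ring
      rw [e, Matrix.exp_add_smul, pow_succ, ← mul_assoc]
      exact (norm_mul_le _ _).trans
        (mul_le_mul (ih s hs) hq1.le (norm_nonneg _) (by positivity))
  -- With `k = ⌊s/n⌋` one only knows `s/n ≤ k + 1`, hence `q^{k+1} ≤ q^{s/n}`; this accounts for the
  -- factor `1/q`.
  refine ⟨C / q, -Real.log q / n, div_pos (neg_pos.2 (Real.log_neg hq0 hq2)) hn', fun s hs => ?_⟩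
  set k := ⌊s / n⌋₊ with hk
  have hk1 : (k : ℝ) * n ≤ s := by
    have := Nat.floor_le (div_nonneg hs hn'.le)
    rwa [le_div_iff₀ hn'] at this
  have hk2 : s ≤ (k + 1) * n := by
    have := (Nat.lt_floor_add_one (s / n)).le
    rwa [div_le_iff₀ hn'] at this
  have h1 := hstep k (s - k * n) ⟨by linarith, by linarith⟩
  rw [sub_add_cancel] at h1
  refine h1.trans ?_
  rw [div_mul_eq_mul_div, le_div_iff₀ hq0, mul_assoc]
  refine mul_le_mul_of_nonneg_left ?_ hC0
  rw [← pow_succ, ← Real.exp_log (pow_pos hq0 (k + 1)), Real.exp_le_exp, Real.log_pow]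
  have hl := Real.log_neg hq0 hq2
  have : -(-Real.log q / n) * s = Real.log q * (s / n) := by ring
  rw [this]
  push_cast
  have h3 : s / n ≤ k + 1 := by rwa [div_le_iff₀ hn']
  nlinarith

theorem IsHurwitz.integrableOn_gramian_integrand {A : Matrix (Fin d) (Fin d) ℝ} (hA : IsHurwitz A)
    (B : Matrix (Fin d) (Fin m) ℝ) : IntegrableOn (fun s : ℝ =>
      NormedSpace.exp (s • A) * (B * Bᵀ) * NormedSpace.exp (s • Aᵀ)) (Set.Ioi 0) := by
  obtain ⟨K, c, hc, hK⟩ := hA.exists_norm_exp_le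
  have hdom : IntegrableOn (fun s : ℝ => K * ‖B * Bᵀ‖ * K * Real.exp (-(2 * c) * s)) (Set.Ioi 0) :=
    (exp_neg_integrableOn_Ioi 0 (by positivity)).const_mul _
  refine hdom.mono' (continuous_gramian_integrand A B).aestronglyMeasurable ?_
  filter_upwards [ae_restrict_mem measurableSet_Ioi] with s hs
  have h1 := hK s (le_of_lt hs)
  have h2 : ‖NormedSpace.exp (s • Aᵀ)‖ ≤ K * Real.exp (-c * s) := by
    rw [← Matrix.transpose_smul, Matrix.exp_transpose,
      ← Matrix.conjTranspose_eq_transpose_of_trivial, Matrix.l2_opNorm_conjTranspose]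
    exact h1
  have h0 : 0 ≤ K * Real.exp (-c * s) := (norm_nonneg _).trans h1
  calc _ ≤ ‖NormedSpace.exp (s • A)‖ * ‖B * Bᵀ‖ * ‖NormedSpace.exp (s • Aᵀ)‖ :=
        (norm_mul_le _ _).trans (mul_le_mul_of_nonneg_right (norm_mul_le _ _) (norm_nonneg _))
    _ ≤ (K * Real.exp (-c * s)) * ‖B * Bᵀ‖ * (K * Real.exp (-c * s)) := by gcongr
    _ = K * ‖B * Bᵀ‖ * K * (Real.exp (-c * s) * Real.exp (-c * s)) := by ring
    _ = _ := by
      rw [← Real.exp_add]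
      ring_nf

theorem gramian_posDef {A : Matrix (Fin d) (Fin d) ℝ} {B : Matrix (Fin d) (Fin m) ℝ}
    (hAB : IsControllable A B) (hA : IsHurwitz A) : (gramian A B).PosDef :=
  hAB.posDef_integral one_pos Set.Ioo_subset_Ioi_self (hA.integrableOn_gramian_integrand B)

end Hurwitz

/-! ### Gaussian measures and Lebesgue measure -/

section GaussianMeasures

open Filter Topology
open scoped MatrixOrder Matrix.Norms.L2Operator

variable {d m : ℕ}

theorem integrable_exp_neg_mul_sq_norm {V : Type*} [NormedAddCommGroup V] [InnerProductSpace ℝ V]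
    [FiniteDimensional ℝ V] [MeasurableSpace V] [BorelSpace V] {b : ℝ} (hb : 0 < b) :
    Integrable fun v : V => Real.exp (-b * ‖v‖ ^ 2) := by
  have h := (GaussianFourier.integrable_cexp_neg_mul_sq_norm_add (V := V) (b := b)
    (by simpa using hb) 0 0).re
  refine h.congr (.of_forall fun v => ?_)
  have : (-(b : ℂ) * (‖v‖ : ℂ) ^ 2 + 0 * (inner ℝ (0 : V) v : ℝ)) =
      ((-b * ‖v‖ ^ 2 : ℝ) : ℂ) := by push_cast; ring
  simp only [this, RCLike.re_eq_complex_re, Complex.exp_ofReal_re]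

/-- The measure with the usual Gaussian density has the same characteristic function, so it is the
standard Gaussian. -/
theorem stdGaussian_absolutelyContinuous (V : Type*) [NormedAddCommGroup V] [InnerProductSpace ℝ V]
    [FiniteDimensional ℝ V] [MeasurableSpace V] [BorelSpace V] :
    stdGaussian V ≪ (volume : Measure V) := by
  set c : ℝ := (Real.pi / (1 / 2)) ^ (Module.finrank ℝ V / 2 : ℝ) with hc
  have hc0 : 0 < c := by positivity
  set ν : Measure V := volume.withDensity fun x =>
    ENNReal.ofReal (c⁻¹ * Real.exp (-(1 / 2) * ‖x‖ ^ 2)) with hν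
  have hint : Integrable fun x : V => c⁻¹ * Real.exp (-(1 / 2) * ‖x‖ ^ 2) :=
    (integrable_exp_neg_mul_sq_norm (by norm_num)).const_mul _
  have : IsFiniteMeasure ν := isFiniteMeasure_withDensity_ofReal hint.2
  have heq : stdGaussian V = ν := by
    refine Measure.ext_of_charFun (funext fun t => ?_)
    rw [charFun_stdGaussian, charFun_apply, hν,
      integral_withDensity_eq_integral_toReal_smul (by fun_prop) (by simp)]
    have h1 := GaussianFourier.integral_cexp_neg_mul_sq_norm_add (V := V) (b := (1 / 2 : ℂ))
      (by norm_num) Complex.I t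
    have h2 : ∀ x : V, (ENNReal.ofReal (c⁻¹ * Real.exp (-(1 / 2) * ‖x‖ ^ 2))).toReal •
        Complex.exp ((inner ℝ x t : ℝ) * Complex.I) = (c⁻¹ : ℂ) *
        Complex.exp (-(1 / 2) * (‖x‖ : ℂ) ^ 2 + Complex.I * (inner ℝ t x : ℝ)) := by
      intro x
      rw [ENNReal.toReal_ofReal (by positivity), Complex.exp_add, Complex.real_smul,
        real_inner_comm, mul_comm Complex.I]
      push_cast
      ring
    simp only [h2]
    rw [integral_const_mul, h1, hc]
    have h3 : (((Real.pi / (1 / 2)) ^ (Module.finrank ℝ V / 2 : ℝ) : ℝ) : ℂ) =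
        ((Real.pi : ℂ) / (1 / 2)) ^ (Module.finrank ℝ V / 2 : ℂ) := by
      rw [Complex.ofReal_cpow (by positivity)]
      push_cast
      rfl
    rw [← h3, inv_mul_cancel_left₀ (by exact_mod_cast hc0.ne')]
    congr 1
    rw [Complex.I_sq]
    ring
  rw [heq]
  exact withDensity_absolutelyContinuous _ _

/-- It is the image of the standard Gaussian under `x ↦ μ + S^{1/2} x`, and since `det S^{1/2} ≠ 0`
preimages of null sets are null. -/
theorem multivariateGaussian_absolutelyContinuous (μ : EuclideanSpace ℝ (Fin d))
    {S : Matrix (Fin d) (Fin d) ℝ} (hS : S.PosDef) :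
    multivariateGaussian μ S ≪ (volume : Measure (EuclideanSpace ℝ (Fin d))) := by
  set f : EuclideanSpace ℝ (Fin d) →ₗ[ℝ] EuclideanSpace ℝ (Fin d) :=
    (Matrix.toEuclideanCLM (𝕜 := ℝ) (CFC.sqrt S)).toLinearMap with hf
  have hdet : LinearMap.det f ≠ 0 := by
    have : f = Matrix.toEuclideanLin (CFC.sqrt S) := rfl
    rw [this, Matrix.toEuclideanLin_eq_toLin_orthonormal, LinearMap.det_toLin,
      hS.posSemidef.det_sqrt, RCLike.sqrt_of_nonneg hS.det_pos.le]
    exact (Real.sqrt_pos.2 hS.det_pos).ne'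
  rw [multivariateGaussian]
  refine ((stdGaussian_absolutelyContinuous _).map (by fun_prop)).trans ?_
  refine Measure.AbsolutelyContinuous.mk fun s hs h0 => ?_
  rw [Measure.map_apply (by fun_prop) hs]
  have : (fun x => μ + (Matrix.toEuclideanCLM (𝕜 := ℝ) (CFC.sqrt S)) x) ⁻¹' s =
      f ⁻¹' ((fun x => μ + x) ⁻¹' s) := rfl
  rw [this, Measure.addHaar_preimage_linearMap _ hdet, measure_preimage_add, h0, mul_zero]

/-- The constant is the minimum of the form on the unit sphere, extended by homogeneity; an empty
sphere means the space is zero. -/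
theorem Matrix.PosDef.exists_mul_sq_norm_le {S : Matrix (Fin d) (Fin d) ℝ} (hS : S.PosDef) :
    ∃ c : ℝ, 0 < c ∧ ∀ x : EuclideanSpace ℝ (Fin d), c * ‖x‖ ^ 2 ≤ x.ofLp ⬝ᵥ (S *ᵥ x.ofLp) := by
  rcases (Metric.sphere (0 : EuclideanSpace ℝ (Fin d)) 1).eq_empty_or_nonempty with he | hne
  · refine ⟨1, one_pos, fun x => ?_⟩
    rcases eq_or_ne x 0 with rfl | hx
    · simp
    · have : ‖x‖⁻¹ • x ∈ Metric.sphere (0 : EuclideanSpace ℝ (Fin d)) 1 := by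
        simp [norm_smul, hx]
      rw [he] at this
      exact this.elim
  have hcont : Continuous fun x : EuclideanSpace ℝ (Fin d) => x.ofLp ⬝ᵥ (S *ᵥ x.ofLp) := by
    simp only [dotProduct, Matrix.mulVec]
    fun_prop
  obtain ⟨y, hy, hmin⟩ := (isCompact_sphere (0 : EuclideanSpace ℝ (Fin d)) 1).exists_isMinOn hne
    hcont.continuousOn
  have hy0 : y.ofLp ≠ 0 := by
    intro h
    have : y = 0 := WithLp.ofLp_injective 2 h
    simp [this] at hy
  refine ⟨_, by simpa using hS.dotProduct_mulVec_pos hy0, fun x => ?_⟩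
  rcases eq_or_ne x 0 with rfl | hx
  · simp
  have hx' : ‖x‖ ≠ 0 := norm_ne_zero_iff.2 hx
  have h := isMinOn_iff.1 hmin (‖x‖⁻¹ • x) (by simp [norm_smul, hx])
  simp only [WithLp.ofLp_smul, Matrix.mulVec_smul, dotProduct_smul, smul_dotProduct,
    smul_eq_mul] at h
  calc _ ≤ (‖x‖⁻¹ * (‖x‖⁻¹ * (x.ofLp ⬝ᵥ (S *ᵥ x.ofLp)))) * ‖x‖ ^ 2 := by gcongr
    _ = _ := by field_simp

theorem isFiniteMeasure_stationaryMeasure {A : Matrix (Fin d) (Fin d) ℝ}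
    {B : Matrix (Fin d) (Fin m) ℝ} (hS : (gramian A B).PosDef) :
    IsFiniteMeasure (stationaryMeasure A B) := by
  obtain ⟨c, hc, hcx⟩ := hS.inv.exists_mul_sq_norm_le
  have hcont : Continuous fun x : EuclideanSpace ℝ (Fin d) =>
      x.ofLp ⬝ᵥ ((gramian A B)⁻¹ *ᵥ x.ofLp) := by
    simp only [dotProduct, Matrix.mulVec]
    fun_prop
  refine isFiniteMeasure_withDensity_ofReal (Integrable.const_mul ?_ _).2
  refine (integrable_exp_neg_mul_sq_norm (b := c / 2) (by positivity)).mono'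
    (by fun_prop) (.of_forall fun x => ?_)
  rw [Real.norm_eq_abs, Real.abs_exp, Real.exp_le_exp]
  linarith [hcx x]

/-- The density is strictly positive. This direction shows that `μ`-null sets are not charged by the
transition laws. -/
theorem absolutelyContinuous_stationaryMeasure {A : Matrix (Fin d) (Fin d) ℝ}
    {B : Matrix (Fin d) (Fin m) ℝ} (hS : (gramian A B).PosDef) :
    (volume : Measure (EuclideanSpace ℝ (Fin d))) ≪ stationaryMeasure A B := by
  have hcont : Continuous fun x : EuclideanSpace ℝ (Fin d) =>
      x.ofLp ⬝ᵥ ((gramian A B)⁻¹ *ᵥ x.ofLp) := by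
    simp only [dotProduct, Matrix.mulVec]
    fun_prop
  refine withDensity_absolutelyContinuous' (by fun_prop) (.of_forall fun x => ?_)
  have := hS.det_pos
  simp only [ne_eq, ENNReal.ofReal_eq_zero, not_le]
  positivity

end GaussianMeasures

/-! ### Riemann-Stieltjes sums -/

section RiemannSums

open Filter Topology

/-- The points of the uniform partition of `[0, t]` into `n + 1` intervals. -/
noncomputable def gridPoint (t : ℝ≥0) (n k : ℕ) : ℝ≥0 := t * k / (n + 1)

theorem gridPoint_zero (t : ℝ≥0) (n : ℕ) : gridPoint t n 0 = 0 := by simp [gridPoint]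

theorem gridPoint_last (t : ℝ≥0) (n : ℕ) : gridPoint t n (n + 1) = t := by
  rw [gridPoint]
  push_cast
  exact mul_div_cancel_right₀ _ (by positivity)

theorem gridPoint_monotone (t : ℝ≥0) (n : ℕ) : Monotone (gridPoint t n) := by
  intro a b hab
  unfold gridPoint
  gcongr

theorem gridPoint_le {t : ℝ≥0} {n k : ℕ} (hk : k ≤ n + 1) : gridPoint t n k ≤ t :=
  (gridPoint_monotone t n hk).trans_eq (gridPoint_last t n)

theorem gridPoint_succ_sub (t : ℝ≥0) (n k : ℕ) :
    (gridPoint t n (k + 1) : ℝ) - gridPoint t n k = t / (n + 1) := by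
  simp only [gridPoint]
  push_cast
  ring

/-- Each increment of `ψ` is the integral of `ψ'` over its cell, so the error is controlled by the
oscillation of `u`. The tags are arbitrary because left endpoints are needed for summation by parts
and right endpoints for the variance. -/
theorem tendsto_sum_gridPoint {t : ℝ≥0} {ψ ψ' u : ℝ → ℝ} (hψ : ∀ s, HasDerivAt ψ (ψ' s) s)
    (hψ' : Continuous ψ') (hu : Continuous u) {τ : ℕ → ℕ → ℝ}
    (hτ : ∀ n k, τ n k ∈ Set.Icc (gridPoint t n k : ℝ) (gridPoint t n (k + 1))) :
    Tendsto (fun n => ∑ k ∈ Finset.range (n + 1),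
        (ψ (gridPoint t n (k + 1)) - ψ (gridPoint t n k)) * u (τ n k)) atTop
      (𝓝 (∫ s in (0 : ℝ)..t, ψ' s * u s)) := by
  obtain ⟨M, hM⟩ := (isCompact_Icc (a := (0 : ℝ)) (b := t)).exists_bound_of_continuousOn
    hψ'.continuousOn
  have hM0 : 0 ≤ M := (norm_nonneg _).trans (hM 0 ⟨le_rfl, t.2⟩)
  have huc := (isCompact_Icc (a := (0 : ℝ)) (b := t)).uniformContinuousOn_of_continuous
    hu.continuousOn
  rw [Metric.uniformContinuousOn_iff] at huc
  rw [Metric.tendsto_atTop]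
  intro ε hε
  -- The summand `1` avoids division by zero and makes the final bound `M t / (M t + 1) * ε`
  -- strictly smaller than `ε`.
  have hMt : 0 < M * t + 1 := by positivity
  obtain ⟨δ, hδ, huδ⟩ := huc (ε / (M * t + 1)) (by positivity)
  obtain ⟨N, hN⟩ := exists_nat_gt ((t : ℝ) / δ)
  refine ⟨N, fun n hn => ?_⟩
  have hmesh : (t : ℝ) / (n + 1) < δ := by
    have : (N : ℝ) ≤ n := by exact_mod_cast hn
    rw [div_lt_iff₀ hδ] at hN
    rw [div_lt_iff₀ (by positivity)]
    nlinarith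
  have hprod : Continuous fun s => ψ' s * u s := hψ'.mul hu
  have hsplit : ∫ s in (0 : ℝ)..t, ψ' s * u s = ∑ k ∈ Finset.range (n + 1),
      ∫ s in (gridPoint t n k : ℝ)..gridPoint t n (k + 1), ψ' s * u s := by
    rw [intervalIntegral.sum_integral_adjacent_intervals (a := fun k => (gridPoint t n k : ℝ))
      fun k _ => hprod.intervalIntegrable _ _, gridPoint_zero, gridPoint_last]
    rfl
  have hterm : ∀ k, (ψ (gridPoint t n (k + 1)) - ψ (gridPoint t n k)) * u (τ n k) =
      ∫ s in (gridPoint t n k : ℝ)..gridPoint t n (k + 1), ψ' s * u (τ n k) := by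
    intro k
    rw [intervalIntegral.integral_mul_const, intervalIntegral.integral_eq_sub_of_hasDerivAt
      (fun s _ => hψ s) (hψ'.intervalIntegrable _ _)]
  rw [dist_eq_norm, hsplit, ← Finset.sum_sub_distrib]
  have hbound : ∀ k ∈ Finset.range (n + 1),
      ‖(ψ (gridPoint t n (k + 1)) - ψ (gridPoint t n k)) * u (τ n k) -
        ∫ s in (gridPoint t n k : ℝ)..gridPoint t n (k + 1), ψ' s * u s‖ ≤
      M * (ε / (M * t + 1)) * (t / (n + 1)) := by
    intro k hk
    have hle : (gridPoint t n k : ℝ) ≤ gridPoint t n (k + 1) :=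
      gridPoint_monotone t n (Nat.le_succ k)
    have hlt : (gridPoint t n (k + 1) : ℝ) ≤ t :=
      gridPoint_le (Finset.mem_range.1 hk)
    rw [hterm, ← intervalIntegral.integral_sub
      ((hψ'.intervalIntegrable _ _).mul_const _) (hprod.intervalIntegrable _ _)]
    refine (intervalIntegral.norm_integral_le_of_norm_le_const (C := M * (ε / (M * t + 1)))
      fun s hs => ?_).trans_eq ?_
    · rw [Set.uIoc_of_le hle] at hs
      have h0 : (0 : ℝ) ≤ gridPoint t n k := (gridPoint t n k).2
      have hs' : s ∈ Set.Icc (0 : ℝ) t := ⟨by linarith [hs.1], hs.2.trans hlt⟩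
      have hτ' : τ n k ∈ Set.Icc (0 : ℝ) t := ⟨h0.trans (hτ n k).1, (hτ n k).2.trans hlt⟩
      rw [← mul_sub, norm_mul]
      refine mul_le_mul (hM s hs') ?_ (norm_nonneg _) hM0
      rw [← dist_eq_norm]
      refine (huδ _ hτ' _ hs' ?_).le
      rw [Real.dist_eq, abs_lt]
      have := gridPoint_succ_sub t n k
      constructor <;> linarith [hs.1, hs.2, (hτ n k).1, (hτ n k).2]
    · rw [gridPoint_succ_sub, abs_of_nonneg (by positivity)]
  refine ((norm_sum_le _ _).trans (Finset.sum_le_sum hbound)).trans_lt ?_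
  rw [Finset.sum_const, Finset.card_range, nsmul_eq_mul]
  push_cast
  have : ((n : ℝ) + 1) * (M * (ε / (M * t + 1)) * (t / (n + 1))) = (M * t / (M * t + 1)) * ε := by
    field_simp
  rw [this]
  have h1 : M * t / (M * t + 1) < 1 := by
    rw [div_lt_one hMt]
    linarith
  nlinarith

end RiemannSums

/-! ### Wiener sums -/

section WienerSums

open Filter Topology

/-- The Riemann sum `∑ φ(s_{k+1}) (p(s_{k+1}) - p(s_k))` along the uniform partition. -/
noncomputable def wienerSum (φ : ℝ → ℝ) (t : ℝ≥0) (n : ℕ) (p : ℝ≥0 → ℝ) : ℝ :=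
  ∑ k ∈ Finset.range (n + 1),
    φ (gridPoint t n (k + 1)) * (p (gridPoint t n (k + 1)) - p (gridPoint t n k))

theorem measurable_wienerSum (φ : ℝ → ℝ) (t : ℝ≥0) (n : ℕ) : Measurable (wienerSum φ t n) := by
  unfold wienerSum
  fun_prop

/-- Summation by parts moves the increments from `p` to `φ`, so continuity of `p` suffices and the
limit exists for each Brownian path separately. -/
theorem tendsto_wienerSum {φ φ' : ℝ → ℝ} (hφ : ∀ s, HasDerivAt φ (φ' s) s) (hφ' : Continuous φ')
    {p : ℝ≥0 → ℝ} (hp : Continuous p) (hp0 : p 0 = 0) (t : ℝ≥0) :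
    Tendsto (fun n => wienerSum φ t n p) atTop
      (𝓝 (φ t * p t - ∫ s in (0 : ℝ)..t, φ' s * p s.toNNReal)) := by
  have h := tendsto_sum_gridPoint (t := t) hφ hφ' (hp.comp continuous_real_toNNReal)
    (τ := fun n k => gridPoint t n k)
    fun n k => ⟨le_rfl, gridPoint_monotone t n (Nat.le_succ k)⟩
  refine (h.const_sub (φ t * p t)).congr fun n => ?_
  have htel := Finset.sum_range_sub
    (fun k => φ (gridPoint t n k) * p (gridPoint t n k)) (n + 1)
  rw [gridPoint_last, gridPoint_zero, hp0, mul_zero, sub_zero] at htel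
  rw [← htel, ← Finset.sum_sub_distrib, wienerSum]
  refine Finset.sum_congr rfl fun k _ => ?_
  simp only [Function.comp_apply, Real.toNNReal_coe]
  ring

theorem tendsto_sum_sq_gridPoint {φ : ℝ → ℝ} (hφ : Continuous φ) (t : ℝ≥0) :
    Tendsto (fun n => ∑ k ∈ Finset.range (n + 1), φ (gridPoint t n (k + 1)) ^ 2 *
        ((gridPoint t n (k + 1) : ℝ) - gridPoint t n k)) atTop
      (𝓝 (∫ s in (0 : ℝ)..t, φ s ^ 2)) := by
  have h := tendsto_sum_gridPoint (t := t) (ψ := id) (ψ' := fun _ => 1) hasDerivAt_id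
    continuous_const (hφ.pow 2) (τ := fun n k => gridPoint t n (k + 1))
    fun n k => ⟨gridPoint_monotone t n (Nat.le_succ k), le_rfl⟩
  simp only [one_mul, id] at h
  refine h.congr fun n => Finset.sum_congr rfl fun k _ => mul_comm _ _

variable {Ω : Type*} [MeasurableSpace Ω] {P : Measure Ω}

theorem charFun_map_const_mul_gaussian {Z : Ω → ℝ} {v : ℝ≥0} (hZ : HasLaw Z (gaussianReal 0 v) P)
    (c u : ℝ) : charFun (P.map fun ω => c * Z ω) u =
      Complex.exp (-(((c * u) ^ 2 * v / 2 : ℝ) : ℂ)) := by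
  have hZc := gaussianReal_const_mul hZ c
  rw [hZc.map_eq, charFun_gaussianReal]
  congr 1
  push_cast
  simp
  ring

/-- The sum consists of independent centred Gaussians. Frequency `1` is enough, because the
frequency vector is later built into the weight `φ`. -/
theorem ProbabilityTheory.IsPreBrownianReal.charFun_map_wienerSum {W : ℝ≥0 → Ω → ℝ}
    (hW : IsPreBrownianReal W P) (φ : ℝ → ℝ) (t : ℝ≥0) (n : ℕ) :
    charFun (P.map fun ω => wienerSum φ t n fun s => W s ω) 1 =
      Complex.exp (-((∑ k ∈ Finset.range (n + 1), φ (gridPoint t n (k + 1)) ^ 2 *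
        ((gridPoint t n (k + 1) : ℝ) - gridPoint t n k) / 2 : ℝ) : ℂ)) := by
  have hind := (hW.hasIndepIncrements.nat (gridPoint_monotone t n)).comp
    (fun k x => φ (gridPoint t n (k + 1)) * x) (fun k => by fun_prop)
  have hmeas : ∀ k ∈ Finset.range (n + 1), AEMeasurable
      ((fun x => φ (gridPoint t n (k + 1)) * x) ∘
        fun ω => W (gridPoint t n (k + 1)) ω - W (gridPoint t n k) ω) P := fun k _ =>
    ((hW.aemeasurable _).sub (hW.aemeasurable _)).const_mul _
  have h := iIndepFun.charFun_map_fun_finsetSum_eq_prod hmeas (hind.restrict _)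
  have h1 := congrFun h 1
  simp only [Function.comp_apply] at h1
  refine h1.trans ?_
  rw [Finset.prod_apply, Complex.ofReal_sum, ← Finset.sum_neg_distrib,
    Complex.exp_sum]
  refine Finset.prod_congr rfl fun k _ => ?_
  have hlaw := hW.hasLaw_sub (gridPoint t n (k + 1)) (gridPoint t n k)
  refine (charFun_map_const_mul_gaussian hlaw (φ (gridPoint t n (k + 1))) 1).trans ?_
  rw [coe_nndist, Real.dist_eq, abs_of_nonneg (sub_nonneg.2
    (by exact_mod_cast gridPoint_monotone t n (Nat.le_succ k))), mul_one]
  rfl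

end WienerSums

/-! ### The law of the solution -/

section Law

open scoped Matrix.Norms.L2Operator
open Filter Topology

variable {d m : ℕ}

theorem HasDerivAt.dotProduct {ι : Type*} [Fintype ι] {f g : ℝ → ι → ℝ} {f' g' : ι → ℝ} {s : ℝ}
    (hf : HasDerivAt f f' s) (hg : HasDerivAt g g' s) :
    HasDerivAt (fun u => f u ⬝ᵥ g u) (f' ⬝ᵥ g s + f s ⬝ᵥ g') s := by
  simp only [_root_.dotProduct, ← Finset.sum_add_distrib]
  exact HasDerivAt.fun_sum fun i _ => (hasDerivAt_pi.1 hf i).mul (hasDerivAt_pi.1 hg i)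

theorem dotProduct_exp_smul_mulVec (A : Matrix (Fin d) (Fin d) ℝ) (t : ℝ) (w x : Fin d → ℝ) :
    (NormedSpace.exp (t • Aᵀ) *ᵥ w) ⬝ᵥ x = w ⬝ᵥ (NormedSpace.exp (t • A) *ᵥ x) := by
  rw [← Matrix.transpose_smul, Matrix.exp_transpose, Matrix.mulVec_transpose,
    ← Matrix.dotProduct_mulVec]

/-- A pathwise statement: `Y = ξ - Bη` is differentiable although `η` is merely continuous.
Differentiating `e^{(t-s)Aᵀ} w · Y(s)` leaves only `Aᵀ e^{(t-s)Aᵀ} w · B η(s)`. -/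
theorem variation_of_constants {A : Matrix (Fin d) (Fin d) ℝ} {B : Matrix (Fin d) (Fin m) ℝ}
    {ξ : ℝ → EuclideanSpace ℝ (Fin d)} {η : ℝ → EuclideanSpace ℝ (Fin m)}
    {x : EuclideanSpace ℝ (Fin d)} (hξ : Continuous ξ)
    (h : ∀ s, 0 ≤ s → ξ s = x + (∫ u in (0 : ℝ)..s, A.toEuclideanLin (ξ u)) +
      B.toEuclideanLin (η s)) {t : ℝ} (ht : 0 ≤ t) (w : Fin d → ℝ) :
    w ⬝ᵥ (ξ t).ofLp = w ⬝ᵥ (NormedSpace.exp (t • A) *ᵥ x.ofLp) + (dualOutput A B w 0 ⬝ᵥ (η t).ofLp +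
      ∫ s in (0 : ℝ)..t, dualOutput A B (Aᵀ *ᵥ w) (t - s) ⬝ᵥ (η s).ofLp) := by
  have hAξ : Continuous fun u => A.toEuclideanLin (ξ u) :=
    (LinearMap.continuous_of_finiteDimensional _).comp hξ
  set Y : ℝ → EuclideanSpace ℝ (Fin d) := fun s => x + ∫ u in (0 : ℝ)..s, A.toEuclideanLin (ξ u)
    with hYdef
  have hY : ∀ s, HasDerivAt (fun u => (Y u).ofLp) (A *ᵥ (ξ s).ofLp) s := by
    intro s
    have h1 : HasDerivAt Y (A.toEuclideanLin (ξ s)) s :=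
      (intervalIntegral.integral_hasDerivAt_right (hAξ.intervalIntegrable _ _)
        (hAξ.stronglyMeasurableAtFilter _ _) hAξ.continuousAt).const_add x
    exact (EuclideanSpace.equiv (Fin d) ℝ).toContinuousLinearMap.hasFDerivAt.comp_hasDerivAt s h1
  have hζ : ∀ s, HasDerivAt (fun u : ℝ => NormedSpace.exp ((t - u) • Aᵀ) *ᵥ w)
      (-(Aᵀ *ᵥ (NormedSpace.exp ((t - s) • Aᵀ) *ᵥ w))) s := fun s =>
    (Aᵀ.hasDerivAt_exp_smul_mulVec w (t - s)).comp_const_sub t s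
  have hH : ∀ s, HasDerivAt (fun u : ℝ => (NormedSpace.exp ((t - u) • Aᵀ) *ᵥ w) ⬝ᵥ (Y u).ofLp)
      ((Aᵀ *ᵥ (NormedSpace.exp ((t - s) • Aᵀ) *ᵥ w)) ⬝ᵥ ((ξ s).ofLp - (Y s).ofLp)) s := by
    intro s
    refine ((hζ s).dotProduct (hY s)).congr_deriv ?_
    rw [dotProduct_sub, Matrix.dotProduct_mulVec, ← Matrix.mulVec_transpose, neg_dotProduct]
    ring
  have hYc : Continuous fun u => (Y u).ofLp :=
    continuous_iff_continuousAt.2 fun s => (hY s).continuousAt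
  have hζc : Continuous fun s : ℝ => Aᵀ *ᵥ (NormedSpace.exp ((t - s) • Aᵀ) *ᵥ w) :=
    (LinearMap.continuous_of_finiteDimensional (Matrix.mulVecLin Aᵀ)).comp
      (continuous_iff_continuousAt.2 fun s => (hζ s).continuousAt)
  have hcont : Continuous fun s : ℝ =>
      (Aᵀ *ᵥ (NormedSpace.exp ((t - s) • Aᵀ) *ᵥ w)) ⬝ᵥ ((ξ s).ofLp - (Y s).ofLp) := by
    have hξ' : Continuous fun s => (ξ s).ofLp := by fun_prop
    exact hζc.dotProduct (hξ'.sub hYc)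
  have hftc := intervalIntegral.integral_eq_sub_of_hasDerivAt (fun s _ => hH s)
    (hcont.intervalIntegrable 0 t)
  have hdiff : ∀ s, 0 ≤ s → (ξ s).ofLp - (Y s).ofLp = B *ᵥ (η s).ofLp := by
    intro s hs
    have := congrArg WithLp.ofLp (h s hs)
    rw [this]
    simp [hYdef, Matrix.toLpLin_apply]
  have hcongr : ∫ s in (0 : ℝ)..t,
      (Aᵀ *ᵥ (NormedSpace.exp ((t - s) • Aᵀ) *ᵥ w)) ⬝ᵥ ((ξ s).ofLp - (Y s).ofLp) =
      ∫ s in (0 : ℝ)..t, dualOutput A B (Aᵀ *ᵥ w) (t - s) ⬝ᵥ (η s).ofLp := by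
    refine intervalIntegral.integral_congr fun s hs => ?_
    rw [Set.uIcc_of_le ht] at hs
    simp only
    rw [hdiff s hs.1, Matrix.dotProduct_mulVec, ← Matrix.mulVec_transpose, dualOutput,
      Matrix.mulVec_mulVec w Aᵀ, ← Matrix.exp_smul_mul_self, ← Matrix.mulVec_mulVec w]
  rw [hcongr] at hftc
  have hY0 : Y 0 = x := by simp [hYdef]
  rw [hY0, sub_self, sub_zero, zero_smul, NormedSpace.exp_zero, Matrix.one_mulVec,
    dotProduct_exp_smul_mulVec] at hftc
  have hout : dualOutput A B w 0 ⬝ᵥ (η t).ofLp = w ⬝ᵥ (B *ᵥ (η t).ofLp) := by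
    rw [dualOutput, zero_smul, NormedSpace.exp_zero, Matrix.one_mulVec, Matrix.mulVec_transpose,
      ← Matrix.dotProduct_mulVec]
  rw [hftc, hout, ← hdiff t ht, dotProduct_sub]
  ring

variable {Ω : Type*} [MeasurableSpace Ω] {P : Measure Ω}

/-- The Riemann sum approximating `w ⬝ᵥ X t`. -/
noncomputable def solutionSum (A : Matrix (Fin d) (Fin d) ℝ) (B : Matrix (Fin d) (Fin m) ℝ)
    (x : EuclideanSpace ℝ (Fin d)) (W : ℝ≥0 → Ω → EuclideanSpace ℝ (Fin m)) (t : ℝ≥0)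
    (w : Fin d → ℝ) (n : ℕ) (ω : Ω) : ℝ :=
  w ⬝ᵥ (NormedSpace.exp ((t : ℝ) • A) *ᵥ x.ofLp) +
    ∑ i, wienerSum (fun s => dualOutput A B w (t - s) i) t n fun s => W s ω i

theorem hasDerivAt_dualOutput_const_sub (A : Matrix (Fin d) (Fin d) ℝ)
    (B : Matrix (Fin d) (Fin m) ℝ) (w : Fin d → ℝ) (t s : ℝ) (i : Fin m) :
    HasDerivAt (fun u => dualOutput A B w (t - u) i) (-dualOutput A B (Aᵀ *ᵥ w) (t - s) i) s :=
  hasDerivAt_pi.1 ((hasDerivAt_dualOutput A B w (t - s)).comp_const_sub t s) i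

theorem continuous_dualOutput_const_sub (A : Matrix (Fin d) (Fin d) ℝ)
    (B : Matrix (Fin d) (Fin m) ℝ) (w : Fin d → ℝ) (t : ℝ) (i : Fin m) :
    Continuous fun u => dualOutput A B w (t - u) i :=
  continuous_iff_continuousAt.2 fun s => (hasDerivAt_dualOutput_const_sub A B w t s i).continuousAt

theorem IsBrownianVector.aemeasurable_wienerSum {W : ℝ≥0 → Ω → EuclideanSpace ℝ (Fin m)}
    (hW : IsBrownianVector W P) (φ : ℝ → ℝ) (t : ℝ≥0) (n : ℕ) (i : Fin m) :
    AEMeasurable (fun ω => wienerSum φ t n fun s => W s ω i) P := by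
  have := fun s => (hW.isBrownianReal i).aemeasurable s
  unfold wienerSum
  fun_prop

theorem IsBrownianVector.aemeasurable_solutionSum {A : Matrix (Fin d) (Fin d) ℝ}
    {B : Matrix (Fin d) (Fin m) ℝ} {x : EuclideanSpace ℝ (Fin d)}
    {W : ℝ≥0 → Ω → EuclideanSpace ℝ (Fin m)} (hW : IsBrownianVector W P) (t : ℝ≥0) (w : Fin d → ℝ)
    (n : ℕ) : AEMeasurable (solutionSum A B x W t w n) P :=
  (Finset.aemeasurable_fun_sum _ fun i _ => hW.aemeasurable_wienerSum _ t n i).const_add _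

theorem IsSolutionSDE.tendsto_solutionSum {A : Matrix (Fin d) (Fin d) ℝ}
    {B : Matrix (Fin d) (Fin m) ℝ} {x : EuclideanSpace ℝ (Fin d)}
    {W : ℝ≥0 → Ω → EuclideanSpace ℝ (Fin m)} {X : ℝ≥0 → Ω → EuclideanSpace ℝ (Fin d)}
    (hX : IsSolutionSDE A B x W X P) (t : ℝ≥0) (w : Fin d → ℝ) :
    ∀ᵐ ω ∂P, Tendsto (fun n => solutionSum A B x W t w n ω) atTop (𝓝 (w ⬝ᵥ (X t ω).ofLp)) := by
  have hcont := ae_all_iff.2 fun i => (hX.brownian.isBrownianReal i).cont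
  have hzero := ae_all_iff.2 fun i => (hX.brownian.isBrownianReal i).eval_zero_ae_eq_zero
  filter_upwards [hX.continuous_paths, hX.equation, hcont, hzero] with ω hXc hXe hWc hW0
  have hvoc := variation_of_constants (A := A) (B := B) (ξ := fun s => X s.toNNReal ω)
    (η := fun s => W s.toNNReal ω) (x := x) (hXc.comp continuous_real_toNNReal)
    (fun s hs => by
      have := hXe s.toNNReal
      rwa [Real.coe_toNNReal s hs] at this) t.2 w
  simp only [NNReal.val_eq_coe, Real.toNNReal_coe] at hvoc
  rw [hvoc]
  refine tendsto_const_nhds.add ?_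
  have hsum := tendsto_finsetSum Finset.univ fun (i : Fin m) _ =>
    tendsto_wienerSum (fun s => hasDerivAt_dualOutput_const_sub A B w t s i)
      (continuous_dualOutput_const_sub A B (Aᵀ *ᵥ w) t i).neg (hWc i) (hW0 i) t
  convert hsum using 2
  rw [Finset.sum_sub_distrib, ← intervalIntegral.integral_finsetSum, sub_eq_add_neg,
    ← intervalIntegral.integral_neg]
  · simp [dotProduct]
  · intro i _
    exact ((continuous_dualOutput_const_sub A B (Aᵀ *ᵥ w) t i).neg.mul
      ((hWc i).comp continuous_real_toNNReal)).intervalIntegrable _ _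

/-- Measurability is not part of being a solution; it follows because each coordinate is an almost
sure limit of sums of Brownian increments. -/
theorem IsSolutionSDE.aemeasurable {A : Matrix (Fin d) (Fin d) ℝ}
    {B : Matrix (Fin d) (Fin m) ℝ} {x : EuclideanSpace ℝ (Fin d)}
    {W : ℝ≥0 → Ω → EuclideanSpace ℝ (Fin m)} {X : ℝ≥0 → Ω → EuclideanSpace ℝ (Fin d)}
    (hX : IsSolutionSDE A B x W X P) (t : ℝ≥0) : AEMeasurable (X t) P := by
  have h : ∀ i, AEMeasurable (fun ω => X t ω i) P := by
    intro i
    have h1 := aemeasurable_of_tendsto_metrizable_ae atTop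
      (fun n => hX.brownian.aemeasurable_solutionSum (A := A) (B := B) (x := x) t (Pi.single i 1) n)
      (hX.tendsto_solutionSum t (Pi.single i 1))
    simpa using h1
  exact (WithLp.measurable_toLp 2 _).comp_aemeasurable (aemeasurable_pi_lambda _ h)

theorem IsBrownianVector.integral_exp_solutionSum [IsProbabilityMeasure P]
    {A : Matrix (Fin d) (Fin d) ℝ}
    {B : Matrix (Fin d) (Fin m) ℝ} {x : EuclideanSpace ℝ (Fin d)}
    {W : ℝ≥0 → Ω → EuclideanSpace ℝ (Fin m)} (hW : IsBrownianVector W P) (t : ℝ≥0) (w : Fin d → ℝ)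
    (n : ℕ) : ∫ ω, Complex.exp ((solutionSum A B x W t w n ω : ℝ) * Complex.I) ∂P =
      Complex.exp ((w ⬝ᵥ (NormedSpace.exp ((t : ℝ) • A) *ᵥ x.ofLp) : ℝ) * Complex.I) *
      Complex.exp (-((∑ i, ∑ k ∈ Finset.range (n + 1),
        dualOutput A B w (t - gridPoint t n (k + 1)) i ^ 2 *
        ((gridPoint t n (k + 1) : ℝ) - gridPoint t n k) / 2 : ℝ) : ℂ)) := by
  have hind := hW.iIndepFun.comp
    (fun i => wienerSum (fun s => dualOutput A B w (t - s) i) t n)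
    (fun i => measurable_wienerSum _ t n)
  have hprod := congrFun (hind.charFun_map_fun_sum_eq_prod
    (fun i => hW.aemeasurable_wienerSum (fun s => dualOutput A B w (t - s) i) t n i)) 1
  rw [Finset.prod_apply, charFun_apply, integral_map
    (Finset.aemeasurable_fun_sum _ fun i _ => hW.aemeasurable_wienerSum _ t n i)
    (by fun_prop)] at hprod
  have hcoord : ∀ i, charFun (P.map fun ω => wienerSum (fun s => dualOutput A B w (t - s) i) t n
      fun s => W s ω i) 1 = _ := fun i =>
    (hW.isBrownianReal i).charFun_map_wienerSum (fun s => dualOutput A B w (t - s) i) t n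
  simp only at hprod
  simp only [hcoord] at hprod
  rw [Complex.ofReal_sum, ← Finset.sum_neg_distrib, Complex.exp_sum, ← hprod, ← integral_const_mul]
  refine integral_congr_ae (.of_forall fun ω => ?_)
  simp only [solutionSum]
  rw [← Complex.exp_add]
  congr 1
  simp
  ring

theorem IsSolutionSDE.charFun_map [IsProbabilityMeasure P] {A : Matrix (Fin d) (Fin d) ℝ}
    {B : Matrix (Fin d) (Fin m) ℝ} {x : EuclideanSpace ℝ (Fin d)}
    {W : ℝ≥0 → Ω → EuclideanSpace ℝ (Fin m)} {X : ℝ≥0 → Ω → EuclideanSpace ℝ (Fin d)}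
    (hX : IsSolutionSDE A B x W X P) (t : ℝ≥0) (w : EuclideanSpace ℝ (Fin d)) :
    charFun (P.map (X t)) w =
      Complex.exp ((w.ofLp ⬝ᵥ (NormedSpace.exp ((t : ℝ) • A) *ᵥ x.ofLp) : ℝ) * Complex.I) *
      Complex.exp (-((w.ofLp ⬝ᵥ (transitionCov A B t *ᵥ w.ofLp) / 2 : ℝ) : ℂ)) := by
  have hlim : Tendsto (fun n => ∫ ω, Complex.exp
      ((solutionSum A B x W t w.ofLp n ω : ℝ) * Complex.I) ∂P) atTop
      (𝓝 (∫ ω, Complex.exp ((w.ofLp ⬝ᵥ (X t ω).ofLp : ℝ) * Complex.I) ∂P)) := by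
    refine tendsto_integral_of_dominated_convergence (fun _ => 1) (fun n => ?_)
      (integrable_const _) (fun n => .of_forall fun ω => ?_) ?_
    · have := hX.brownian.aemeasurable_solutionSum (A := A) (B := B) (x := x) t w.ofLp n
      exact AEMeasurable.aestronglyMeasurable (by fun_prop)
    · rw [Complex.norm_exp_ofReal_mul_I]
    · filter_upwards [hX.tendsto_solutionSum t w.ofLp] with ω hω
      exact ((Complex.continuous_exp.comp (Complex.continuous_ofReal.mul continuous_const)).tendsto
        _).comp hω
  have hvar : Tendsto (fun n => ∑ i, ∑ k ∈ Finset.range (n + 1),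
        dualOutput A B w.ofLp (t - gridPoint t n (k + 1)) i ^ 2 *
        ((gridPoint t n (k + 1) : ℝ) - gridPoint t n k) / 2) atTop
      (𝓝 (w.ofLp ⬝ᵥ (transitionCov A B t *ᵥ w.ofLp) / 2)) := by
    have h := tendsto_finsetSum Finset.univ fun (i : Fin m) _ =>
      tendsto_sum_sq_gridPoint (continuous_dualOutput_const_sub A B w.ofLp t i) t
    have h2 := h.div_const 2
    simp only [Finset.sum_div] at h2
    convert h2 using 2
    rw [dotProduct_transitionCov t.coe_nonneg, ← Finset.sum_div, ← intervalIntegral.integral_finsetSum]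
    · have hsub := intervalIntegral.integral_comp_sub_left (a := 0) (b := t)
        (fun s => dualOutput A B w.ofLp s ⬝ᵥ dualOutput A B w.ofLp s) (t : ℝ)
      rw [sub_self, sub_zero] at hsub
      rw [← hsub]
      simp [dotProduct, sq]
    · intro i _
      exact ((continuous_dualOutput_const_sub A B w.ofLp t i).pow 2).intervalIntegrable _ _
  have hlim2 := (Complex.continuous_exp.tendsto _).comp
    ((Complex.continuous_ofReal.neg.tendsto _).comp hvar)
  have hlim3 := hlim2.const_mul
    (Complex.exp ((w.ofLp ⬝ᵥ (NormedSpace.exp ((t : ℝ) • A) *ᵥ x.ofLp) : ℝ) * Complex.I))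
  rw [charFun_apply, integral_map (hX.aemeasurable t) (by fun_prop)]
  have hinner : ∀ ω, inner ℝ (X t ω) w = w.ofLp ⬝ᵥ (X t ω).ofLp := fun ω => by
    rw [EuclideanSpace.inner_eq_star_dotProduct, star_trivial]
  simp only [hinner]
  refine tendsto_nhds_unique hlim (hlim3.congr fun n => ?_)
  exact (hX.brownian.integral_exp_solutionSum t w.ofLp n).symm

end Law

/-! ### Functions in a scalar reproducing kernel Hilbert space -/

section ScalarRKHS

variable {X H : Type*} [NormedAddCommGroup H] [InnerProductSpace ℝ H] [CompleteSpace H]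
  [RKHS ℝ H X ℝ]

/-- The bound makes `∑ c_x k_x ↦ ∑ c_x F(x)` a well-defined functional of norm at most `C` on the
span of the kernel functions. Hahn–Banach extends it, Riesz represents it by some `h`, and the
reproducing property reads off `h = F`. -/
theorem RKHS.exists_of_forall_abs_sum_le (F : X → ℝ) {C : ℝ} (hC : 0 ≤ C)
    (hF : ∀ c : X →₀ ℝ, |c.sum fun x a => a * F x| ≤
      C * ‖c.sum fun x a => a • RKHS.kerFun H x (1 : ℝ)‖) :
    ∃ h : H, (∀ x, h x = F x) ∧ ‖h‖ ≤ C := by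
  set Φ : (X →₀ ℝ) →ₗ[ℝ] H := Finsupp.linearCombination ℝ fun x => RKHS.kerFun H x (1 : ℝ) with hΦ
  set ℓ : (X →₀ ℝ) →ₗ[ℝ] ℝ := Finsupp.linearCombination ℝ F with hℓ
  have hbound : ∀ c, |ℓ c| ≤ C * ‖Φ c‖ := hF
  obtain ⟨s, hs⟩ := Φ.rangeRestrict.exists_rightInverse_of_surjective Φ.range_rangeRestrict
  have hs' : ∀ y : LinearMap.range Φ, Φ (s y) = y := fun y =>
    congrArg Subtype.val (LinearMap.congr_fun hs y)
  let g : StrongDual ℝ (LinearMap.range Φ) := (ℓ ∘ₗ s).mkContinuous C fun y => by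
    have := hbound (s y)
    rwa [hs'] at this
  have hg : ∀ c, g ⟨Φ c, c, rfl⟩ = ℓ c := by
    intro c
    -- The bound forces `ℓ` to vanish on the kernel of `Φ`, so the choice of the section `s` is
    -- immaterial.
    have h := hbound (s ⟨Φ c, c, rfl⟩ - c)
    rw [map_sub, map_sub, hs', sub_self, norm_zero, mul_zero] at h
    exact sub_eq_zero.1 (abs_nonpos_iff.1 h)
  obtain ⟨G, hG, hGn⟩ := exists_extension_norm_eq (LinearMap.range Φ) g
  refine ⟨(InnerProductSpace.toDual ℝ H).symm G, fun x => ?_, ?_⟩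
  · have h1 : G (RKHS.kerFun H x (1 : ℝ)) = F x := by
      have e : Φ (Finsupp.single x 1) = RKHS.kerFun H x (1 : ℝ) := by simp [hΦ]
      have h2 := hG ⟨Φ (Finsupp.single x 1), _, rfl⟩
      rw [hg] at h2
      simp only [e] at h2
      rw [h2]
      simp [hℓ]
    rw [← h1, ← InnerProductSpace.toDual_symm_apply, RKHS.inner_kerFun]
    simp
  · rw [LinearIsometryEquiv.norm_map, hGn]
    exact LinearMap.mkContinuous_norm_le _ hC _

end ScalarRKHS

/-! ### The Gaussian RKHS -/

section GaussianRKHS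

open Filter Topology

variable {d : ℕ} {σ : ℝ}

/-- The kernel function `k^σ(·, y)` as an element of the Gaussian RKHS. -/
noncomputable def rbfFun (σ : ℝ) (y : EuclideanSpace ℝ (Fin d)) : GaussianRKHS d σ :=
  RKHS.kerFun (GaussianRKHS d σ) y (1 : ℝ)

theorem inner_rbfFun_left (y : EuclideanSpace ℝ (Fin d)) (f : GaussianRKHS d σ) :
    inner ℝ (rbfFun σ y) f = f y := by
  rw [rbfFun, RKHS.kerFun_inner]
  simp

theorem inner_rbfFun_rbfFun (x y : EuclideanSpace ℝ (Fin d)) :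
    inner ℝ (rbfFun σ x) (rbfFun σ y) = Real.exp (-‖x - y‖ ^ 2 / σ ^ 2) := by
  rw [inner_rbfFun_left, rbfFun, RKHS.kerFun_apply, RKHS.OfKernel.kernel_ofKernel]
  simp [rbfKernel]

theorem norm_rbfFun (y : EuclideanSpace ℝ (Fin d)) : ‖rbfFun σ y‖ = 1 := by
  have h := inner_rbfFun_rbfFun (σ := σ) y y
  rw [real_inner_self_eq_norm_sq, sub_self, norm_zero] at h
  exact (pow_eq_one_iff_of_nonneg (norm_nonneg _) two_ne_zero).1 (by simpa using h)

theorem continuous_rbfFun (σ : ℝ) : Continuous (rbfFun (d := d) σ) := by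
  have h : ∀ x y : EuclideanSpace ℝ (Fin d), dist (rbfFun σ x) (rbfFun σ y) =
      √(2 - 2 * Real.exp (-‖x - y‖ ^ 2 / σ ^ 2)) := by
    intro x y
    rw [dist_eq_norm, ← Real.sqrt_sq (norm_nonneg _), norm_sub_sq_real, norm_rbfFun, norm_rbfFun,
      inner_rbfFun_rbfFun]
    congr 1
    ring
  rw [continuous_iff_continuousAt]
  intro y
  rw [ContinuousAt, tendsto_iff_dist_tendsto_zero]
  simp only [h]
  have hc : Continuous fun x : EuclideanSpace ℝ (Fin d) =>
      √(2 - 2 * Real.exp (-‖x - y‖ ^ 2 / σ ^ 2)) := by fun_prop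
  simpa using hc.tendsto y

theorem GaussianRKHS.continuous (f : GaussianRKHS d σ) : Continuous f := by
  have : ⇑f = fun y => inner ℝ (rbfFun σ y) f := funext fun y => (inner_rbfFun_left y f).symm
  rw [this]
  exact (continuous_rbfFun σ).inner continuous_const

theorem GaussianRKHS.norm_apply_le (f : GaussianRKHS d σ) (y : EuclideanSpace ℝ (Fin d)) :
    ‖f y‖ ≤ ‖f‖ := by
  rw [← inner_rbfFun_left]
  exact (norm_inner_le_norm _ _).trans_eq (by rw [norm_rbfFun, one_mul])

theorem GaussianRKHS.integrable (f : GaussianRKHS d σ) (ρ : Measure (EuclideanSpace ℝ (Fin d)))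
    [IsFiniteMeasure ρ] : Integrable f ρ :=
  Integrable.of_bound f.continuous.aestronglyMeasurable ‖f‖ (.of_forall f.norm_apply_le)

theorem integrable_rbfFun (ρ : Measure (EuclideanSpace ℝ (Fin d))) [IsFiniteMeasure ρ] :
    Integrable (rbfFun σ) ρ :=
  Integrable.of_bound (continuous_rbfFun σ).aestronglyMeasurable 1
    (.of_forall fun y => (norm_rbfFun y).le)

/-- The kernel mean embedding `∫ k^σ(·, y) dρ(y)`. -/
noncomputable def meanEmbedding (σ : ℝ) (ρ : Measure (EuclideanSpace ℝ (Fin d))) :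
    GaussianRKHS d σ :=
  ∫ y, rbfFun σ y ∂ρ

theorem inner_meanEmbedding (ρ : Measure (EuclideanSpace ℝ (Fin d))) [IsFiniteMeasure ρ]
    (f : GaussianRKHS d σ) : inner ℝ (meanEmbedding σ ρ) f = ∫ y, f y ∂ρ := by
  rw [meanEmbedding, real_inner_comm, ← integral_inner (integrable_rbfFun ρ)]
  refine integral_congr_ae (.of_forall fun y => ?_)
  simp only
  rw [real_inner_comm, inner_rbfFun_left]

theorem meanEmbedding_dirac (x : EuclideanSpace ℝ (Fin d)) :
    meanEmbedding σ (Measure.dirac x) = rbfFun σ x :=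
  integral_dirac _ _

theorem inner_meanEmbedding_meanEmbedding (ρ ρ' : Measure (EuclideanSpace ℝ (Fin d)))
    [IsFiniteMeasure ρ] [IsFiniteMeasure ρ'] :
    inner ℝ (meanEmbedding σ ρ) (meanEmbedding σ ρ') =
      ∫ x, ∫ y, Real.exp (-‖x - y‖ ^ 2 / σ ^ 2) ∂ρ' ∂ρ := by
  rw [inner_meanEmbedding]
  refine integral_congr_ae (.of_forall fun x => ?_)
  simp only
  rw [← inner_rbfFun_left, real_inner_comm, inner_meanEmbedding]
  refine integral_congr_ae (.of_forall fun y => ?_)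
  simp only
  rw [← inner_rbfFun_left, inner_rbfFun_rbfFun, norm_sub_rev]

end GaussianRKHS

/-! ### Fourier representation of the Gaussian RKHS norm -/

section Fourier

open Filter Topology
open scoped ComplexConjugate

variable {d m : ℕ} {σ : ℝ}

/-- The normalization constant of the spectral density of the RBF kernel. -/
noncomputable def rbfConst (d : ℕ) (σ : ℝ) : ℝ :=
  ((Real.pi / (σ ^ 2 / 4)) ^ (d / 2 : ℝ))⁻¹

theorem rbfConst_nonneg (d : ℕ) (σ : ℝ) : 0 ≤ rbfConst d σ := by
  unfold rbfConst
  positivity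

/-- The Gaussian is its own Fourier transform up to scaling. Splitting the character of `x - y` into
two factors separates the variables for Fubini. -/
theorem rbf_eq_fourier (hσ : 0 < σ) (x y : EuclideanSpace ℝ (Fin d)) :
    ((Real.exp (-‖x - y‖ ^ 2 / σ ^ 2) : ℝ) : ℂ) = rbfConst d σ *
      ∫ w : EuclideanSpace ℝ (Fin d), Complex.exp ((inner ℝ x w : ℝ) * Complex.I) *
        conj (Complex.exp ((inner ℝ y w : ℝ) * Complex.I)) *
        (Real.exp (-(σ ^ 2 / 4) * ‖w‖ ^ 2) : ℝ) := by
  have hb : 0 < σ ^ 2 / 4 := by positivity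
  have h := GaussianFourier.integral_cexp_neg_mul_sq_norm_add
    (b := ((σ ^ 2 / 4 : ℝ) : ℂ)) (by rwa [Complex.ofReal_re]) Complex.I (x - y)
  have h2 : ∀ w : EuclideanSpace ℝ (Fin d), Complex.exp ((inner ℝ x w : ℝ) * Complex.I) *
        conj (Complex.exp ((inner ℝ y w : ℝ) * Complex.I)) *
        (Real.exp (-(σ ^ 2 / 4) * ‖w‖ ^ 2) : ℝ) =
      Complex.exp (-((σ ^ 2 / 4 : ℝ) : ℂ) * (‖w‖ : ℂ) ^ 2 +
        Complex.I * (inner ℝ (x - y) w : ℝ)) := by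
    intro w
    rw [← Complex.exp_conj, Complex.ofReal_exp, ← Complex.exp_add, ← Complex.exp_add,
      inner_sub_left]
    congr 1
    simp only [map_mul, Complex.conj_ofReal, Complex.conj_I]
    push_cast
    ring
  simp only [h2]
  rw [h, rbfConst, finrank_euclideanSpace_fin]
  have h3 : (((Real.pi / (σ ^ 2 / 4)) ^ (d / 2 : ℝ) : ℝ) : ℂ) =
      ((Real.pi : ℂ) / ((σ ^ 2 / 4 : ℝ) : ℂ)) ^ (d / 2 : ℂ) := by
    rw [Complex.ofReal_cpow (by positivity)]
    push_cast
    rfl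
  have h4 : (Real.pi / (σ ^ 2 / 4)) ^ (d / 2 : ℝ) ≠ 0 := by positivity
  rw [← h3, Complex.ofReal_inv, inv_mul_cancel_left₀ (by exact_mod_cast h4), Complex.ofReal_exp]
  congr 1
  rw [Complex.I_sq]
  push_cast
  field_simp

theorem inner_meanEmbedding_eq_fourier (hσ : 0 < σ) (ρ ρ' : Measure (EuclideanSpace ℝ (Fin d)))
    [IsFiniteMeasure ρ] [IsFiniteMeasure ρ'] :
    ((inner ℝ (meanEmbedding σ ρ) (meanEmbedding σ ρ') : ℝ) : ℂ) = rbfConst d σ *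
      ∫ w, charFun ρ w * conj (charFun ρ' w) * (Real.exp (-(σ ^ 2 / 4) * ‖w‖ ^ 2) : ℝ) := by
  have hcont : Continuous fun p : EuclideanSpace ℝ (Fin d) × EuclideanSpace ℝ (Fin d) =>
      Real.exp (-‖p.1 - p.2‖ ^ 2 / σ ^ 2) := by fun_prop
  have hint : Integrable (fun p : EuclideanSpace ℝ (Fin d) × EuclideanSpace ℝ (Fin d) =>
      Real.exp (-‖p.1 - p.2‖ ^ 2 / σ ^ 2)) (ρ.prod ρ') := by
    refine Integrable.of_bound hcont.aestronglyMeasurable 1 (.of_forall fun p => ?_)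
    rw [Real.norm_eq_abs, Real.abs_exp, Real.exp_le_one_iff, neg_div, neg_nonpos]
    positivity
  have hG := integrable_exp_neg_mul_sq_norm (V := EuclideanSpace ℝ (Fin d))
    (b := σ ^ 2 / 4) (by positivity)
  rw [inner_meanEmbedding_meanEmbedding, integral_integral hint, ← integral_complex_ofReal]
  simp only [rbf_eq_fourier hσ]
  rw [integral_const_mul, integral_integral_swap]
  · congr 1
    refine integral_congr_ae (.of_forall fun w => ?_)
    simp only
    rw [integral_mul_const, integral_prod_mul
      (fun x => Complex.exp ((inner ℝ x w : ℝ) * Complex.I))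
      (fun y => conj (Complex.exp ((inner ℝ y w : ℝ) * Complex.I))), integral_conj, charFun_apply,
      charFun_apply]
  · refine Integrable.mono' ((integrable_const (1 : ℝ)).mul_prod hG)
      (Continuous.aestronglyMeasurable ?_) (.of_forall fun q => ?_)
    · simp only [Function.uncurry_def]
      have := Complex.continuous_conj
      fun_prop
    · simp only [Function.uncurry_def, norm_mul, RCLike.norm_conj, Complex.norm_exp_ofReal_mul_I,
        Complex.norm_real, Real.norm_eq_abs, Real.abs_exp, one_mul, le_refl]

/-- This turns the comparison of norms in `ℍ_σ` into a pointwise comparison of integrands; point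
masses give the kernel functions themselves. -/
theorem norm_sum_meanEmbedding_sq (hσ : 0 < σ) {ι : Type*} (s : Finset ι) (a : ι → ℝ)
    (ρ : ι → Measure (EuclideanSpace ℝ (Fin d))) [∀ i, IsProbabilityMeasure (ρ i)] :
    ‖∑ i ∈ s, a i • meanEmbedding σ (ρ i)‖ ^ 2 = rbfConst d σ *
      ∫ w, ‖∑ i ∈ s, (a i : ℂ) * charFun (ρ i) w‖ ^ 2 * Real.exp (-(σ ^ 2 / 4) * ‖w‖ ^ 2) := by
  have hG := integrable_exp_neg_mul_sq_norm (V := EuclideanSpace ℝ (Fin d))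
    (b := σ ^ 2 / 4) (by positivity)
  have hint : ∀ i j, Integrable fun w => ((a i : ℂ) * (a j : ℂ)) *
      (charFun (ρ i) w * conj (charFun (ρ j) w) *
        (Real.exp (-(σ ^ 2 / 4) * ‖w‖ ^ 2) : ℝ)) := by
    intro i j
    refine Integrable.const_mul (Integrable.mono' hG ?_ (.of_forall fun w => ?_)) _
    · have h1 : Measurable (charFun (ρ i)) := measurable_charFun
      have h2 : Measurable (charFun (ρ j)) := measurable_charFun
      have := Complex.continuous_conj.measurable
      exact Measurable.aestronglyMeasurable (by fun_prop)
    · rw [norm_mul, norm_mul, RCLike.norm_conj, Complex.norm_real, Real.norm_eq_abs, Real.abs_exp]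
      have h1 := norm_charFun_le_one (μ := ρ i) w
      have h2 := norm_charFun_le_one (μ := ρ j) w
      calc _ ≤ 1 * 1 * Real.exp (-(σ ^ 2 / 4) * ‖w‖ ^ 2) := by gcongr
        _ = _ := by ring
  rw [← Complex.ofReal_inj, ← real_inner_self_eq_norm_sq, sum_inner]
  simp only [inner_sum, inner_smul_left, inner_smul_right]
  push_cast
  rw [← integral_complex_ofReal]
  have hw : ∀ w, ((‖∑ i ∈ s, (a i : ℂ) * charFun (ρ i) w‖ ^ 2 *
      Real.exp (-(σ ^ 2 / 4) * ‖w‖ ^ 2) : ℝ) : ℂ) =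
      ∑ i ∈ s, ∑ j ∈ s, ((a i : ℂ) * (a j : ℂ)) * (charFun (ρ i) w * conj (charFun (ρ j) w) *
        (Real.exp (-(σ ^ 2 / 4) * ‖w‖ ^ 2) : ℝ)) := by
    intro w
    rw [Complex.ofReal_mul, Complex.ofReal_pow, ← Complex.mul_conj', map_sum, Finset.sum_mul_sum,
      Finset.sum_mul]
    refine Finset.sum_congr rfl fun i _ => ?_
    rw [Finset.sum_mul]
    refine Finset.sum_congr rfl fun j _ => ?_
    rw [map_mul, Complex.conj_ofReal]
    ring
  simp only [hw]
  rw [integral_finsetSum _ fun i _ => integrable_finsetSum _ fun j _ => hint i j, Finset.mul_sum]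
  refine Finset.sum_congr rfl fun i _ => ?_
  rw [integral_finsetSum _ fun j _ => hint i j, Finset.mul_sum]
  refine Finset.sum_congr rfl fun j _ => ?_
  rw [integral_const_mul, inner_meanEmbedding_eq_fourier hσ]
  simp
  ring

end Fourier

/-! ### The Koopman operators on the Gaussian RKHS -/

section Koopman

open scoped Matrix.Norms.L2Operator
open Filter Topology

variable {d m : ℕ} {σ : ℝ}

theorem LyapunovCondition.dotProduct_le {A : Matrix (Fin d) (Fin d) ℝ}
    {B : Matrix (Fin d) (Fin m) ℝ} (h : LyapunovCondition A B σ) (z : Fin d → ℝ) :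
    z ⬝ᵥ (Aᵀ *ᵥ z) ≤ 1 / σ ^ 2 * ((Bᵀ *ᵥ z) ⬝ᵥ (Bᵀ *ᵥ z)) := by
  have h1 := h.dotProduct_mulVec_nonneg z
  rw [star_trivial, Matrix.sub_mulVec, dotProduct_sub, Matrix.smul_mulVec, Matrix.smul_mulVec,
    dotProduct_smul, dotProduct_smul, Matrix.add_mulVec, dotProduct_add] at h1
  have h2 : z ⬝ᵥ (A *ᵥ z) = z ⬝ᵥ (Aᵀ *ᵥ z) := by
    rw [Matrix.dotProduct_mulVec, ← Matrix.mulVec_transpose, dotProduct_comm]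
  have h3 : z ⬝ᵥ ((B * Bᵀ) *ᵥ z) = (Bᵀ *ᵥ z) ⬝ᵥ (Bᵀ *ᵥ z) := by
    rw [← Matrix.mulVec_mulVec, Matrix.dotProduct_mulVec, ← Matrix.mulVec_transpose]
  rw [h2, h3, smul_eq_mul, smul_eq_mul] at h1
  linarith

theorem LyapunovCondition.norm_exp_sq_le {A : Matrix (Fin d) (Fin d) ℝ}
    {B : Matrix (Fin d) (Fin m) ℝ} (h : LyapunovCondition A B σ) (hσ : 0 < σ) {t : ℝ} (ht : 0 ≤ t)
    (w : EuclideanSpace ℝ (Fin d)) :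
    σ ^ 2 / 4 * ‖Matrix.toEuclideanLin (NormedSpace.exp (t • Aᵀ)) w‖ ^ 2 ≤
      σ ^ 2 / 4 * ‖w‖ ^ 2 + w.ofLp ⬝ᵥ (transitionCov A B t *ᵥ w.ofLp) := by
  set ζ : ℝ → Fin d → ℝ := fun s => NormedSpace.exp (s • Aᵀ) *ᵥ w.ofLp with hζ
  have hζd : ∀ s, HasDerivAt ζ (Aᵀ *ᵥ ζ s) s := Aᵀ.hasDerivAt_exp_smul_mulVec w.ofLp
  have hc : Continuous fun s => dualOutput A B w.ofLp s ⬝ᵥ dualOutput A B w.ofLp s :=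
    (continuous_dualOutput A B w.ofLp).dotProduct (continuous_dualOutput A B w.ofLp)
  -- With `ζ(s) = e^{sAᵀ} w`, the claim is that this energy at time `t` is at least its value at
  -- `0`.
  have hE : ∀ s, HasDerivAt (fun u => (∫ r in (0 : ℝ)..u,
      dualOutput A B w.ofLp r ⬝ᵥ dualOutput A B w.ofLp r) - σ ^ 2 / 4 * (ζ u ⬝ᵥ ζ u))
      (dualOutput A B w.ofLp s ⬝ᵥ dualOutput A B w.ofLp s -
        σ ^ 2 / 4 * ((Aᵀ *ᵥ ζ s) ⬝ᵥ ζ s + ζ s ⬝ᵥ (Aᵀ *ᵥ ζ s))) s := fun s =>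
    (intervalIntegral.integral_hasDerivAt_right (hc.intervalIntegrable _ _)
      (hc.stronglyMeasurableAtFilter _ _) hc.continuousAt).sub
      (((hζd s).dotProduct (hζd s)).const_mul _)
  have hmono := monotone_of_deriv_nonneg (fun s => (hE s).differentiableAt) fun s => by
    rw [(hE s).deriv, dotProduct_comm (Aᵀ *ᵥ ζ s)]
    have h1 := h.dotProduct_le (ζ s)
    -- The Lyapunov condition bounds the subtracted term by half of `|Bᵀ ζ|²`; nonnegativity of the
    -- other half finishes.
    have h2 : 0 ≤ dualOutput A B w.ofLp s ⬝ᵥ dualOutput A B w.ofLp s :=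
      Finset.sum_nonneg fun i _ => mul_self_nonneg _
    have h3 : σ ^ 2 * (ζ s ⬝ᵥ (Aᵀ *ᵥ ζ s)) ≤
        dualOutput A B w.ofLp s ⬝ᵥ dualOutput A B w.ofLp s := by
      rw [one_div, ← div_eq_inv_mul, le_div_iff₀ (by positivity), mul_comm] at h1
      exact h1
    linarith
  have h0 := hmono ht
  have hnorm : ∀ v : EuclideanSpace ℝ (Fin d), ‖v‖ ^ 2 = v.ofLp ⬝ᵥ v.ofLp := fun v => by
    rw [EuclideanSpace.real_norm_sq_eq]
    simp [dotProduct, sq]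
  rw [hnorm, hnorm, dotProduct_transitionCov ht]
  simp only [intervalIntegral.integral_same, hζ, zero_smul, NormedSpace.exp_zero,
    Matrix.one_mulVec] at h0
  simp only [Matrix.toLpLin_apply]
  linarith

theorem integral_comp_toEuclideanLin {M : Matrix (Fin d) (Fin d) ℝ} (hM : M.det ≠ 0)
    {g : EuclideanSpace ℝ (Fin d) → ℝ} (hg : Integrable g) :
    Integrable (fun w => g (Matrix.toEuclideanLin M w)) ∧
      ∫ w, g (Matrix.toEuclideanLin M w) = |M.det|⁻¹ * ∫ w, g w := by
  have hdet : LinearMap.det (Matrix.toEuclideanLin M) = M.det := by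
    rw [Matrix.toEuclideanLin_eq_toLin_orthonormal, LinearMap.det_toLin]
  have hmap := Measure.map_linearMap_addHaar_eq_smul_addHaar
    (volume : Measure (EuclideanSpace ℝ (Fin d))) (f := Matrix.toEuclideanLin M) (hdet ▸ hM)
  have hmeas : Measurable (Matrix.toEuclideanLin M) :=
    (LinearMap.continuous_of_finiteDimensional _).measurable
  have hg' : Integrable g (Measure.map (Matrix.toEuclideanLin M) volume) := by
    rw [hmap]
    exact hg.smul_measure ENNReal.ofReal_ne_top
  refine ⟨hg'.comp_measurable hmeas, ?_⟩
  rw [← integral_map hmeas.aemeasurable hg'.aestronglyMeasurable, hmap, integral_smul_measure,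
    ENNReal.toReal_ofReal (abs_nonneg _), hdet, abs_inv, smul_eq_mul]

theorem norm_sum_meanEmbedding_le {A : Matrix (Fin d) (Fin d) ℝ} {B : Matrix (Fin d) (Fin m) ℝ}
    (h : LyapunovCondition A B σ) (hσ : 0 < σ) {t : ℝ} (ht : 0 ≤ t)
    {ρ : EuclideanSpace ℝ (Fin d) → Measure (EuclideanSpace ℝ (Fin d))}
    [∀ x, IsProbabilityMeasure (ρ x)]
    (hρ : ∀ x w, charFun (ρ x) w =
      Complex.exp ((w.ofLp ⬝ᵥ (NormedSpace.exp (t • A) *ᵥ x.ofLp) : ℝ) * Complex.I) *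
      Complex.exp (-((w.ofLp ⬝ᵥ (transitionCov A B t *ᵥ w.ofLp) / 2 : ℝ) : ℂ)))
    (s : Finset (EuclideanSpace ℝ (Fin d))) (a : EuclideanSpace ℝ (Fin d) → ℝ) :
    ‖∑ x ∈ s, a x • meanEmbedding σ (ρ x)‖ ≤
      Real.exp (t * (-A).trace / 2) * ‖∑ x ∈ s, a x • rbfFun σ x‖ := by
  set L := NormedSpace.exp (t • Aᵀ) with hL
  have hdet : L.det = Real.exp (t * A.trace) := by
    rw [hL, Matrix.det_exp_smul, Matrix.trace_transpose]
  set g : EuclideanSpace ℝ (Fin d) → ℝ := fun w =>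
    ‖∑ x ∈ s, (a x : ℂ) * charFun (Measure.dirac x) w‖ ^ 2 *
      Real.exp (-(σ ^ 2 / 4) * ‖w‖ ^ 2) with hg
  have hG := integrable_exp_neg_mul_sq_norm (V := EuclideanSpace ℝ (Fin d))
    (b := σ ^ 2 / 4) (by positivity)
  have hgi : Integrable g := by
    refine Integrable.mono' (hG.const_mul ((∑ x ∈ s, |a x|) ^ 2)) ?_ (.of_forall fun w => ?_)
    · have : ∀ x : EuclideanSpace ℝ (Fin d), Measurable (charFun (Measure.dirac x)) :=
        fun x => measurable_charFun
      exact Measurable.aestronglyMeasurable (by fun_prop)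
    · rw [hg, norm_mul, norm_pow, norm_norm, Real.norm_eq_abs, Real.abs_exp]
      gcongr
      refine (norm_sum_le _ _).trans (Finset.sum_le_sum fun x _ => ?_)
      rw [norm_mul, Complex.norm_real, Real.norm_eq_abs]
      exact mul_le_of_le_one_right (abs_nonneg _) (norm_charFun_le_one w)
  obtain ⟨hci, hcomp⟩ := integral_comp_toEuclideanLin (M := L)
    (by rw [hdet]; exact (Real.exp_pos _).ne') hgi
  have hdirac : ‖∑ x ∈ s, a x • rbfFun σ x‖ ^ 2 = rbfConst d σ * ∫ w, g w := by
    have := norm_sum_meanEmbedding_sq hσ s a (fun x => Measure.dirac x)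
    simpa only [meanEmbedding_dirac] using this
  have hle : ∀ w, ‖∑ x ∈ s, (a x : ℂ) * charFun (ρ x) w‖ ^ 2 *
      Real.exp (-(σ ^ 2 / 4) * ‖w‖ ^ 2) ≤ g (Matrix.toEuclideanLin L w) := by
    intro w
    -- The Gaussian factor does not depend on `x`, so it comes out of the sum, and `e^{tA}` passes
    -- to the frequency as its transpose `L`.
    have hsum : ∑ x ∈ s, (a x : ℂ) * charFun (ρ x) w =
        (∑ x ∈ s, (a x : ℂ) * charFun (Measure.dirac x) (Matrix.toEuclideanLin L w)) *
        Complex.exp (-((w.ofLp ⬝ᵥ (transitionCov A B t *ᵥ w.ofLp) / 2 : ℝ) : ℂ)) := by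
      rw [Finset.sum_mul]
      refine Finset.sum_congr rfl fun x _ => ?_
      rw [hρ, charFun_dirac, EuclideanSpace.inner_eq_star_dotProduct, star_trivial, mul_assoc,
        Matrix.toLpLin_apply, dotProduct_exp_smul_mulVec]
    rw [hsum, norm_mul, mul_pow, ← Complex.ofReal_neg, Complex.norm_exp_ofReal, ← Real.exp_nat_mul,
      mul_assoc, ← Real.exp_add]
    refine mul_le_mul_of_nonneg_left (Real.exp_le_exp.2 ?_) (by positivity)
    have := h.norm_exp_sq_le hσ ht w
    push_cast
    linarith
  have hkey : ‖∑ x ∈ s, a x • meanEmbedding σ (ρ x)‖ ^ 2 ≤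
      Real.exp (-(t * A.trace)) * ‖∑ x ∈ s, a x • rbfFun σ x‖ ^ 2 := by
    rw [norm_sum_meanEmbedding_sq hσ, hdirac, mul_left_comm]
    refine mul_le_mul_of_nonneg_left ?_ (rbfConst_nonneg d σ)
    rw [Real.exp_neg, ← hdet, ← abs_of_pos (a := L.det) (by rw [hdet]; exact Real.exp_pos _),
      ← hcomp]
    exact integral_mono_of_nonneg (.of_forall fun w => by positivity) hci (.of_forall hle)
  refine le_of_sq_le_sq ?_ (by positivity)
  refine hkey.trans_eq ?_
  rw [mul_pow, ← Real.exp_nat_mul, Matrix.trace_neg]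
  congr 2
  push_cast
  ring

end Koopman

/-! ### Invariance of the Gaussian RKHS -/

theorem IsDissipative.lyapunovCondition {d m : ℕ} {A : Matrix (Fin d) (Fin d) ℝ}
    (hA : IsDissipative A) (B : Matrix (Fin d) (Fin m) ℝ) (σ : ℝ) : LyapunovCondition A B σ := by
  have h1 : ((1 / σ ^ 2) • (B * Bᵀ)).PosSemidef := by
    rw [← Matrix.conjTranspose_eq_transpose_of_trivial]
    exact (Matrix.posSemidef_self_mul_conjTranspose B).smul (by positivity)
  have h2 : ((1 / 2 : ℝ) • -(A + Aᵀ)).PosSemidef := Matrix.PosSemidef.smul hA (by norm_num)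
  have h3 := h1.add h2
  rwa [smul_neg, ← sub_eq_add_neg] at h3

section Solution

variable {d m : ℕ} {Ω : Type*} [MeasurableSpace Ω] {P : Measure Ω}
  {A : Matrix (Fin d) (Fin d) ℝ} {B : Matrix (Fin d) (Fin m) ℝ} {x : EuclideanSpace ℝ (Fin d)}
  {W : ℝ≥0 → Ω → EuclideanSpace ℝ (Fin m)} {X : ℝ≥0 → Ω → EuclideanSpace ℝ (Fin d)}

theorem IsSolutionSDE.eval_zero (hX : IsSolutionSDE A B x W X P) : ∀ᵐ ω ∂P, X 0 ω = x := by
  have hzero := ae_all_iff.2 fun i => (hX.brownian.isBrownianReal i).eval_zero_ae_eq_zero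
  filter_upwards [hX.equation, hzero] with ω hω h0
  have hW : W 0 ω = 0 := by
    ext i
    exact h0 i
  rw [hω 0, hW]
  simp

theorem IsSolutionSDE.map_eq_multivariateGaussian [IsProbabilityMeasure P]
    (hX : IsSolutionSDE A B x W X P) {t : ℝ≥0} (hS : (transitionCov A B t).PosSemidef) :
    P.map (X t) = multivariateGaussian
      (WithLp.toLp 2 (NormedSpace.exp ((t : ℝ) • A) *ᵥ x.ofLp)) (transitionCov A B t) := by
  have := Measure.isProbabilityMeasure_map (hX.aemeasurable t)
  refine Measure.ext_of_charFun (funext fun w => ?_)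
  rw [hX.charFun_map, charFun_multivariateGaussian hS, ← Complex.exp_add,
    EuclideanSpace.inner_eq_star_dotProduct, star_trivial,
    dotProduct_comm (NormedSpace.exp ((t : ℝ) • A) *ᵥ x.ofLp)]
  push_cast
  rw [sub_eq_add_neg]

theorem IsSolutionSDE.map_absolutelyContinuous [IsProbabilityMeasure P]
    (hX : IsSolutionSDE A B x W X P) (hAB : IsControllable A B) {t : ℝ≥0} (ht : 0 < t) :
    P.map (X t) ≪ volume := by
  have hS := hAB.transitionCov_posDef (t := t) (by exact_mod_cast ht)
  rw [hX.map_eq_multivariateGaussian hS.posSemidef]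
  exact multivariateGaussian_absolutelyContinuous _ hS

end Solution

theorem exists_gaussianRKHS_eq_koopman {d m : ℕ} {A : Matrix (Fin d) (Fin d) ℝ}
    {B : Matrix (Fin d) (Fin m) ℝ} {Ω : Type*} [MeasurableSpace Ω]
    {P : EuclideanSpace ℝ (Fin d) → Measure Ω} [∀ x, IsProbabilityMeasure (P x)]
    {W : EuclideanSpace ℝ (Fin d) → ℝ≥0 → Ω → EuclideanSpace ℝ (Fin m)}
    {X : EuclideanSpace ℝ (Fin d) → ℝ≥0 → Ω → EuclideanSpace ℝ (Fin d)}
    (hX : ∀ x, IsSolutionSDE A B x (W x) (X x) (P x)) {σ : ℝ} (hσ : 0 < σ)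
    (h : LyapunovCondition A B σ) (t : ℝ≥0) (f : GaussianRKHS d σ) :
    ∃ g : GaussianRKHS d σ, (∀ x, g x = koopman P X t f x) ∧
      ‖g‖ ≤ Real.exp (t * (-A).trace / 2) * ‖f‖ := by
  have hprob : ∀ x, IsProbabilityMeasure ((P x).map (X x t)) := fun x =>
    Measure.isProbabilityMeasure_map ((hX x).aemeasurable t)
  have hK : ∀ x, koopman P X t f x = inner ℝ (meanEmbedding σ ((P x).map (X x t))) f := by
    intro x
    rw [inner_meanEmbedding, integral_map ((hX x).aemeasurable t)
      f.continuous.aestronglyMeasurable, koopman]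
  refine RKHS.exists_of_forall_abs_sum_le _ (by positivity) fun c => ?_
  have hsum : (c.sum fun x a => a * koopman P X t f x) =
      inner ℝ (∑ x ∈ c.support, c x • meanEmbedding σ ((P x).map (X x t))) f := by
    simp only [Finsupp.sum, sum_inner, inner_smul_left, hK]
    simp
  have hle := norm_sum_meanEmbedding_le h hσ t.coe_nonneg
    (fun x w => (hX x).charFun_map t w) c.support c
  rw [hsum, ← Real.norm_eq_abs]
  refine (norm_inner_le_norm _ _).trans ?_
  rw [mul_right_comm]
  exact mul_le_mul_of_nonneg_right hle (norm_nonneg _)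

/-- For `t > 0` the two functions agree at every `x`, since the law of `X_t^x` ignores `μ`-null
sets. At `t = 0` that law is a point mass and `K^0` is the identity, so agreement is only almost
everywhere. -/
theorem koopman_congr_ae {d m : ℕ} {A : Matrix (Fin d) (Fin d) ℝ}
    {B : Matrix (Fin d) (Fin m) ℝ} (hAB : IsControllable A B) (hA : IsHurwitz A)
    {Ω : Type*} [MeasurableSpace Ω]
    {P : EuclideanSpace ℝ (Fin d) → Measure Ω} [∀ x, IsProbabilityMeasure (P x)]
    {W : EuclideanSpace ℝ (Fin d) → ℝ≥0 → Ω → EuclideanSpace ℝ (Fin m)}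
    {X : EuclideanSpace ℝ (Fin d) → ℝ≥0 → Ω → EuclideanSpace ℝ (Fin d)}
    (hX : ∀ x, IsSolutionSDE A B x (W x) (X x) (P x)) (t : ℝ≥0)
    {f g : EuclideanSpace ℝ (Fin d) → ℝ} (hfg : g =ᵐ[stationaryMeasure A B] f) :
    koopman P X t g =ᵐ[stationaryMeasure A B] koopman P X t f := by
  rcases eq_or_ne t 0 with rfl | ht
  · have h0 : ∀ u : EuclideanSpace ℝ (Fin d) → ℝ, koopman P X 0 u = u := by
      intro u
      ext x
      rw [koopman, integral_congr_ae (g := fun _ => u x)]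
      · simp
      · filter_upwards [(hX x).eval_zero] with ω hω
        rw [hω]
    rwa [h0, h0]
  · refine .of_forall fun x => integral_congr_ae ?_
    have hac := ((hX x).map_absolutelyContinuous hAB (pos_iff_ne_zero.2 ht)).trans
      (absolutelyContinuous_stationaryMeasure (gramian_posDef hAB hA))
    exact ae_of_ae_map ((hX x).aemeasurable t) (hac.ae_le hfg)

theorem mainTheorem4 {d m : ℕ} (hmd : m ≤ d)
    (A : Matrix (Fin d) (Fin d) ℝ) (B : Matrix (Fin d) (Fin m) ℝ)
    (hAB : IsControllable A B) (hA : IsHurwitz A)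
    {Ω : Type*} [MeasurableSpace Ω]
    (P : EuclideanSpace ℝ (Fin d) → Measure Ω) [∀ x, IsProbabilityMeasure (P x)]
    (W : EuclideanSpace ℝ (Fin d) → ℝ≥0 → Ω → EuclideanSpace ℝ (Fin m))
    (X : EuclideanSpace ℝ (Fin d) → ℝ≥0 → Ω → EuclideanSpace ℝ (Fin d))
    (hX : ∀ x, IsSolutionSDE A B x (W x) (X x) (P x))
    (σ : ℝ) (hσ : 0 < σ) :
    (IsDissipative A → LyapunovCondition A B σ) ∧
    (LyapunovCondition A B σ → ∀ (t : ℝ≥0) (f : GaussianRKHS d σ),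
      MemLp (⇑f) 2 (stationaryMeasure A B) ∧
      (∀ x, Integrable (fun ω => f (X x t ω)) (P x)) ∧
      ∃ h : GaussianRKHS d σ,
        (∀ x, h x = koopman P X t (⇑f) x) ∧
        (∀ g : EuclideanSpace ℝ (Fin d) → ℝ, g =ᵐ[stationaryMeasure A B] ⇑f →
          koopman P X t g =ᵐ[stationaryMeasure A B] ⇑h) ∧
        ‖h‖ ≤ Real.exp (t * (-A).trace / 2) * ‖f‖) := by
  refine ⟨fun h => h.lyapunovCondition B σ, fun h t f => ?_⟩
  have := isFiniteMeasure_stationaryMeasure (gramian_posDef hAB hA)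
  have hprob : ∀ x, IsProbabilityMeasure ((P x).map (X x t)) := fun x =>
    Measure.isProbabilityMeasure_map ((hX x).aemeasurable t)
  -- Elements of `ℍ_σ` are continuous and bounded by their norm, because `k^σ(y, y) = 1`; finiteness
  -- of the measures does the rest.
  refine ⟨MemLp.of_bound f.continuous.aestronglyMeasurable ‖f‖ (.of_forall f.norm_apply_le),
    fun x => (f.integrable ((P x).map (X x t))).comp_aemeasurable ((hX x).aemeasurable t), ?_⟩
  obtain ⟨k, hk, hkn⟩ := exists_gaussianRKHS_eq_koopman hX hσ h t f
  refine ⟨k, hk, fun g hg => ?_, hkn⟩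
  rw [funext hk]
  exact koopman_congr_ae hAB hA hX t hg
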